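/- Let $(X,\mathscr B,\mu)$ be an atomless standard Borel probability space. All transformations are invertible, bimeasurable maps $X\to X$ preserving $\mu$, and a transformation $S$ is identified with the $\mathbb Z$-action $g\mapsto S^g$ it generates. **Definitions.** $T$ is *weak mixing* if for every finite $\mathscr F\subset\mathscr B$, $\liminf_{g\to\infty}\sum_{A,B\in\mathscr F}|\mu(A\cap T^gB)-\mu(A)\mu(B)|=0$, where $g\to\infty$ means that $g$ leaves every finite subset of $\mathbb Z$. Two transformations $S,T$ of $X$ that generate (essentially) free actions are *Shannon orbit equivalent* (on $X$) if for almost every $x$ the $S$-orbit and the $T$-orbit of $x$ coincide and the measurable cocycles $\kappa,\lambda:X\times\mathbb Z\to\mathbb Z$ given almost everywhere by $T^{\kappa(x,g)}x=S^gx$ and $S^{\lambda(x,g)}x=T^gx$ are such that, for every $g\in\mathbb Z$, the partitions $\{\{x:\kappa(x,g)=h\}\}_{h\in\mathbb Z}$ and $\{\{x:\lambda(x,g)=h\}\}_{h\in\mathbb Z}$ have finite Shannon entropy ($\sum_h-\mu(P_h)\log\mu(P_h)<\infty$). A *cocycle* of $S$ is a measurable map $\alpha:X\times\mathbb Z\to\mathbb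 Z$ such that for almost every $x$ the map $\alpha(x,\cdot)$ is a bijection of $\mathbb Z$ and $\alpha(x,g_1+g_2)=\alpha(S^{g_2}x,g_1)+\alpha(x,g_2)$ for all $g_1,g_2$; then $\alpha(x,\alpha^{-1}(x,g))=g$ defines $\alpha^{-1}$, and $S^{\alpha^{-1}}$ is the action in which $g$ acts by $x\mapsto S^{\alpha^{-1}(x,g)}x$. Actions $S_n$ *converge* to $T$ if $\mu(S_n^{-g}A\,\triangle\,T^{-g}A)\to0$ for all $g\in\mathbb Z$, $A\in\mathscr B$. For $\delta\in\mathbb R$, $\ell\in\mathbb Z$ and a countable measurable partition $\mathscr P$, an action $R$ is *$\delta$-mixing relative to $(\ell,\mathscr P)$* if $$\sum_{P,Q\in\mathscr P}|\mu(P\cap R^{-\ell}Q)-\mu(P)\mu(Q)|<\delta .$$ **Theorem.** 1. Every ergodic transformation $S$ of $X$ is Shannon orbit equivalent to a weak mixing transformation $T$ of $X$. 2. Let $S$ and $T$ be transformations of $X$, and let $(\alpha_n)$ be a sequence of cocycles of $S$ such that the actions $S_n=S^{\alpha_n^{-1}}$ converge to $T$. Suppose that there are integers $\ell_i$, real numbers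 $\delta_i\to0$, indices $n_1<n_2<\cdots$ and countable measurable partitions $\mathscr P_i$ of $X$, with $\mathscr P_{i+1}$ refining $\mathscr P_i$ and all the $\mathscr P_i$ together generating $\mathscr B$ modulo null sets, such that $S_{n_j}$ is $\delta_i$-mixing relative to $(\ell_i,\mathscr P_i)$ for all $j\ge i$. Then $T$ is weak mixing. -/

import Mathlib

open MeasureTheory Filter Topology

noncomputable section

namespace ShannonOE

variable {X : Type*} [MeasurableSpace X]

/-- The `g`-th iterate (`g` any integer) of an invertible transformation:
the map `T ^ g : X → X` of the `ℤ`-action generated by `T`. -/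
def iter (T : X ≃ᵐ X) (g : ℤ) : X → X :=
  ⇑((T.toEquiv : Equiv.Perm X) ^ g)

/-- The `ℤ`-action generated by `T` is (essentially) free. -/
def IsFree (μ : Measure X) (T : X ≃ᵐ X) : Prop :=
  ∀ᵐ x ∂μ, ∀ g : ℤ, g ≠ 0 → iter T g x ≠ x

/-- Weak mixing: for each finite collection `F` of measurable sets,
`liminf_{g → ∞} ∑_{A, B ∈ F} |μ (A ∩ T ^ g B) - μ A * μ B| = 0`,
where `g → ∞` means that `g` leaves every finite subset of `ℤ`. -/
def IsWeakMixing (μ : Measure X) (T : X ≃ᵐ X) : Prop :=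
  ∀ F : Finset (Set X), (∀ A ∈ F, MeasurableSet A) →
    liminf (fun g : ℤ => ∑ A ∈ F, ∑ B ∈ F,
      |μ.real (A ∩ iter T g '' B) - μ.real A * μ.real B|) cofinite = 0

/-- The countable partition of `X` into the level sets of `f : X → ℤ` has finite Shannon entropy
`∑ h, -μ (f = h) * log (μ (f = h))`; all the terms are nonnegative. -/
def HasFiniteShannonEntropy (μ : Measure X) (f : X → ℤ) : Prop :=
  Summable fun h : ℤ => Real.negMulLog (μ.real {x | f x = h})

/-- `S` and `T`, generating free actions on the same space, have the same orbits, and the cocycles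
`κ`, `lam` given by `T ^ κ(x, g) x = S ^ g x` and `S ^ lam(x, g) x = T ^ g x` are such that all
cocycle partitions have finite Shannon entropy. -/
def IsShannonOrbitEquivalent (μ : Measure X) (S T : X ≃ᵐ X) : Prop :=
  IsFree μ S ∧ IsFree μ T ∧
  (∀ᵐ x ∂μ, (Set.range fun g : ℤ => iter S g x) = Set.range fun g : ℤ => iter T g x) ∧
  ∃ κ lam : X → ℤ → ℤ,
    (∀ g, Measurable fun x => κ x g) ∧ (∀ g, Measurable fun x => lam x g) ∧
    (∀ᵐ x ∂μ, ∀ g, iter T (κ x g) x = iter S g x) ∧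
    (∀ᵐ x ∂μ, ∀ g, iter S (lam x g) x = iter T g x) ∧
    (∀ g, HasFiniteShannonEntropy μ fun x => κ x g) ∧
    (∀ g, HasFiniteShannonEntropy μ fun x => lam x g)

/-- `α` is a `ℤ`-valued cocycle of the `ℤ`-action generated by `S`, bijective in the
second variable. -/
structure IsCocycle (μ : Measure X) (S : X ≃ᵐ X) (α : X → ℤ → ℤ) : Prop where
  measurable : ∀ g, Measurable fun x => α x g
  bijective : ∀ᵐ x ∂μ, Function.Bijective (α x)
  cocycle : ∀ᵐ x ∂μ, ∀ g₁ g₂ : ℤ, α x (g₁ + g₂) = α (iter S g₂ x) g₁ + α x g₂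

/-- The action `S ^ (α⁻¹)`: the integer `g` acts by `x ↦ S ^ (α⁻¹(x, g)) x`, where
`α (x, α⁻¹(x, g)) = g`. -/
def twist (S : X ≃ᵐ X) (α : X → ℤ → ℤ) (g : ℤ) (x : X) : X :=
  iter S (Function.invFun (α x) g) x

/-- The maps `R n g` converge to the action of `T`, as `n → ∞`, in the weak topology. -/
def ConvergesTo (μ : Measure X) (R : ℕ → ℤ → X → X) (T : X ≃ᵐ X) : Prop :=
  ∀ g : ℤ, ∀ A : Set X, MeasurableSet A →
    Tendsto (fun n => μ (symmDiff (R n g ⁻¹' A) (iter T g ⁻¹' A))) atTop (𝓝 0)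

/-- `P` is a countable ordered measurable partition of `X`
(a finite one is listed with empty sets added). -/
structure IsMeasurablePartition (P : ℕ → Set X) : Prop where
  measurableSet : ∀ a, MeasurableSet (P a)
  disjoint : Pairwise fun a b => Disjoint (P a) (P b)
  cover : ⋃ a, P a = Set.univ

/-- The partition `Q` refines the partition `P`. -/
def Refines (Q P : ℕ → Set X) : Prop := ∀ a, ∃ b, Q a ⊆ P b

/-- The sets of all the partitions `P n` generate, modulo null sets, the σ-algebra of `X`. -/
def GeneratesModNull (μ : Measure X) (P : ℕ → ℕ → Set X) : Prop :=
  ∀ A : Set X, MeasurableSet A → ∃ B : Set X,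
    MeasurableSet[MeasurableSpace.generateFrom {C | ∃ n a, C = P n a}] B ∧ A =ᵐ[μ] B

/-- The action `R` is `δ`-mixing relative to `(ℓ, P)`: the distribution of `P ∨ R ^ (-ℓ) P` is
within `δ` of the product of the distribution of `P` with itself, in the `ℓ¹` distance. -/
def IsMixingRel (μ : Measure X) (R : ℤ → X → X) (δ : ℝ) (l : ℤ) (P : ℕ → Set X) : Prop :=
  ∑' a : ℕ, ∑' b : ℕ,
    ENNReal.ofReal |μ.real (P a ∩ R l ⁻¹' P b) - μ.real (P a) * μ.real (P b)|
      < ENNReal.ofReal δ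

end ShannonOE

end

/-!
# Weak mixing transformations in Shannon orbit equivalence classes

*A limit criterion.* If actions `S_n` converge to `T` and are `δ_i`-mixing relative to `(l_i, P_i)`
for large `n`, then so is `T`, up to a non-strict inequality, by Fatou's lemma
(`tsum_le_of_convergesTo`). Since the unions of atoms of the `P_i` are dense in the measure algebra
(`exists_atomUnion_measureReal_symmDiff_le`), `T` is mixing along the times `l_i`, which leave every
finite set because the space is atomless (`isWeakMixing_of_tendsto`).

*A weak mixing transformation with given orbits.* The transformation `T` is a limit of conjugates
`T_{n+1} = φ_n T_n φ_n⁻¹` of `T_0 = S`, where `φ_n` permutes the levels of a Rokhlin tower for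
`T_n` and so belongs to the full group. All the `T_n` are ergodic and have the orbits of `S`; what
changes is the order of the orbits. To make `T_{n+1}` almost mixing (`exists_orbit_change`), the
mean ergodic theorem provides a window length `M` such that the averages of `M` consecutive
translates of the first `n` sets of a dense sequence are almost constant. The tower consists of
a large number of runs of a length `h` much larger than `M`, and over a base point `b` gaps of
length `t b < M` are cut out between consecutive runs and moved to the end. In the new order the
time `h` brings a point to the corresponding point of the next run, and so the `h`-th power of
`T_{n+1}` is `T_n ^ (h + t b)` on most of the tower. If `t` is uniformly distributed and independent
of the names of the tower points, the correlations at time `h` become averages over a window of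
length `M`, thus almost those of independent sets (`abs_measureReal_conj_sub_le`).

The transformations `T_n` and `T_{n+1}` differ on a set of measure of order `1 / h`, and the jumps
have length of order `h`. Since `log h / h → 0`, the changes can be made so small that the
logarithms of the distances between `x` and `T_n x` along the `S`-orbit, and between `x` and `S x`
along the `T_n`-orbit, have bounded integrals (`IsOrbitChangeSeq.exists_log_bound`). Then almost
every point is affected by finitely many changes, the limit has the same orbits as `S`, and the
cocycles have finite logarithmic moments, which implies finite Shannon entropy
(`hasFiniteShannonEntropy_of_lintegral`).
-/

open MeasureTheory Filter Topology

noncomputable section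

namespace ShannonOE

/-! ### Iterates, full groups and measurable selections -/

section Iterates

variable {X : Type*} [MeasurableSpace X]

@[simp] theorem iter_zero (T : X ≃ᵐ X) (x : X) : iter T 0 x = x := rfl

@[simp] theorem iter_one (T : X ≃ᵐ X) (x : X) : iter T 1 x = T x := by simp [iter]

theorem iter_add (T : X ≃ᵐ X) (a b : ℤ) (x : X) : iter T (a + b) x = iter T a (iter T b x) := by
  simp [iter, zpow_add]

@[simp] theorem iter_neg_apply_iter (T : X ≃ᵐ X) (a : ℤ) (x : X) :
    iter T (-a) (iter T a x) = x := by
  rw [← iter_add]; simp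

@[simp] theorem iter_apply_iter_neg (T : X ≃ᵐ X) (a : ℤ) (x : X) :
    iter T a (iter T (-a) x) = x := by
  rw [← iter_add]; simp

theorem iter_neg_one (T : X ≃ᵐ X) (x : X) : iter T (-1) x = T.symm x := by
  apply T.injective
  rw [T.apply_symm_apply, ← iter_one T, ← iter_add]; simp

theorem iter_add_one (T : X ≃ᵐ X) (a : ℤ) (x : X) : iter T (a + 1) x = T (iter T a x) := by
  rw [add_comm, iter_add, iter_one]

theorem iter_natCast (T : X ≃ᵐ X) (n : ℕ) : iter T n = T^[n] := by
  induction n with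
  | zero => rfl
  | succ n ih =>
    ext x
    rw [Function.iterate_succ_apply', ← ih, Nat.cast_succ, iter_add_one]

theorem iter_neg_natCast (T : X ≃ᵐ X) (n : ℕ) : iter T (-n : ℤ) = T.symm^[n] := by
  induction n with
  | zero => rfl
  | succ n ih =>
    ext x
    rw [Function.iterate_succ_apply', ← ih, Nat.cast_succ, neg_add_rev, iter_add, iter_neg_one]

@[fun_prop]
theorem measurable_iter (T : X ≃ᵐ X) (g : ℤ) : Measurable (iter T g) := by
  obtain ⟨n, rfl | rfl⟩ := g.eq_nat_or_neg
  · rw [iter_natCast]; exact T.measurable.iterate n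
  · rw [iter_neg_natCast]; exact T.symm.measurable.iterate n

theorem measurePreserving_iter {μ : Measure X} {T : X ≃ᵐ X} (hT : MeasurePreserving T μ μ)
    (g : ℤ) : MeasurePreserving (iter T g) μ μ := by
  obtain ⟨n, rfl | rfl⟩ := g.eq_nat_or_neg
  · rw [iter_natCast]; exact hT.iterate n
  · rw [iter_neg_natCast]; exact (hT.symm).iterate n

theorem image_iter (T : X ≃ᵐ X) (g : ℤ) (A : Set X) : iter T g '' A = iter T (-g) ⁻¹' A := by
  rw [Set.image_eq_preimage_of_inverse (g := iter T (-g))] <;> intro x <;> simp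

theorem iter_injective (T : X ≃ᵐ X) (g : ℤ) : Function.Injective (iter T g) :=
  Function.LeftInverse.injective (iter_neg_apply_iter T g)

theorem measurableEmbedding_iter (T : X ≃ᵐ X) (g : ℤ) : MeasurableEmbedding (iter T g) where
  injective := iter_injective T g
  measurable := measurable_iter T g
  measurableSet_image' := fun s hs => by rw [image_iter]; exact measurable_iter T _ hs

theorem measure_preimage_iter {μ : Measure X} {T : X ≃ᵐ X} (hT : MeasurePreserving T μ μ)
    (g : ℤ) (A : Set X) : μ (iter T g ⁻¹' A) = μ A :=
  (measurePreserving_iter hT g).measure_preimage_emb (measurableEmbedding_iter T g) A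

theorem measure_image_iter {μ : Measure X} {T : X ≃ᵐ X} (hT : MeasurePreserving T μ μ)
    (g : ℤ) (A : Set X) : μ (iter T g '' A) = μ A := by
  rw [image_iter, measure_preimage_iter hT]

theorem measureReal_preimage_iter {μ : Measure X} {T : X ≃ᵐ X} (hT : MeasurePreserving T μ μ)
    (g : ℤ) (A : Set X) : μ.real (iter T g ⁻¹' A) = μ.real A := by
  rw [measureReal_def, measure_preimage_iter hT, measureReal_def]

/-- The conjugate `φ T φ⁻¹`. -/
def conj (φ T : X ≃ᵐ X) : X ≃ᵐ X := (φ.symm.trans T).trans φ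

theorem conj_apply (φ T : X ≃ᵐ X) (x : X) : conj φ T x = φ (T (φ.symm x)) := rfl

theorem iter_conj (φ T : X ≃ᵐ X) (g : ℤ) (x : X) :
    iter (conj φ T) g (φ x) = φ (iter T g x) := by
  have h : ((conj φ T).toEquiv : Equiv.Perm X) = φ.toEquiv * T.toEquiv * (φ.toEquiv)⁻¹ := rfl
  have h2 : ((conj φ T).toEquiv : Equiv.Perm X) ^ g
      = φ.toEquiv * T.toEquiv ^ g * (φ.toEquiv)⁻¹ := by rw [h, conj_zpow]
  have h3 := congrArg (fun e : Equiv.Perm X => e (φ x)) h2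
  simp only [Equiv.Perm.mul_apply] at h3
  refine h3.trans ?_
  have : (φ.toEquiv⁻¹ : Equiv.Perm X) (φ x) = x := φ.toEquiv.symm_apply_apply x
  rw [this]; rfl

/-- Iterating a map that moves each point at most `c` steps along its `T`-orbit. -/
theorem exists_iter_iter {T U : X ≃ᵐ X} {c : ℕ}
    (h : ∀ x, ∃ k : ℤ, |k| ≤ c ∧ U x = iter T k x) (g : ℤ) (x : X) :
    ∃ k : ℤ, |k| ≤ |g| * c ∧ iter U g x = iter T k x := by
  have key : ∀ (n : ℕ) (x : X), ∃ k : ℤ, |k| ≤ n * c ∧ iter U n x = iter T k x := by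
    intro n
    induction n with
    | zero => exact fun x => ⟨0, by simp, rfl⟩
    | succ n ih =>
      intro x
      obtain ⟨k, hk, hkx⟩ := ih x
      obtain ⟨j, hj, hjx⟩ := h (iter U n x)
      refine ⟨j + k, ?_, ?_⟩
      · refine (abs_add_le _ _).trans ?_
        push_cast; linarith
      · rw [Nat.cast_succ, iter_add_one, hjx, hkx, iter_add]
  obtain ⟨n, rfl | rfl⟩ := g.eq_nat_or_neg
  · obtain ⟨k, hk, hkx⟩ := key n x
    exact ⟨k, by simpa using hk, hkx⟩
  · obtain ⟨k, hk, hkx⟩ := key n (iter U (-n : ℤ) x)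
    refine ⟨-k, by simpa using hk, ?_⟩
    rw [iter_apply_iter_neg] at hkx
    conv_rhs => rw [hkx]
    simp

/-- If measurable sets indexed by the integers cover the space then for each point the index of a
set containing it can be chosen measurably and with least absolute value. -/
theorem exists_measurable_int (p : ℤ → Set X) (hp : ∀ k, MeasurableSet (p k))
    (h : ∀ x, ∃ k, x ∈ p k) :
    ∃ f : X → ℤ, Measurable f ∧ ∀ x, x ∈ p (f x) ∧ ∀ k, x ∈ p k → |f x| ≤ |k| := by
  classical
  have h' : ∀ x, ∃ n : ℕ, x ∈ p n ∨ x ∈ p (-n) := by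
    intro x
    obtain ⟨k, hk⟩ := h x
    obtain ⟨n, rfl | rfl⟩ := k.eq_nat_or_neg
    exacts [⟨n, .inl hk⟩, ⟨n, .inr hk⟩]
  have hm : Measurable fun x => Nat.find (h' x) :=
    measurable_find _ fun n => (hp n).union (hp (-n))
  refine ⟨fun x => if x ∈ p (Nat.find (h' x)) then (Nat.find (h' x) : ℤ)
    else -(Nat.find (h' x) : ℤ), ?_, fun x => ?_⟩
  · refine Measurable.ite ?_ ?_ ?_
    · have : {x | x ∈ p (Nat.find (h' x))} =
          ⋃ n : ℕ, ((fun x => Nat.find (h' x)) ⁻¹' {n}) ∩ p n := by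
        ext x; simp
      rw [this]
      exact MeasurableSet.iUnion fun n => (hm (measurableSet_singleton n)).inter (hp n)
    · exact (measurable_from_top (f := fun n : ℕ => (n : ℤ))).comp hm
    · exact (measurable_from_top (f := fun n : ℕ => -(n : ℤ))).comp hm
  · have hfind := Nat.find_spec (h' x)
    constructor
    · beta_reduce
      split_ifs with hx
      · exact hx
      · exact hfind.resolve_left hx
    · intro k hk
      have hle : Nat.find (h' x) ≤ k.natAbs := by
        apply Nat.find_min'
        rcases k.natAbs_eq with h | h
        · left; rwa [← h]
        · right; rwa [← h]
      have : |(if x ∈ p (Nat.find (h' x)) then (Nat.find (h' x) : ℤ)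
          else -(Nat.find (h' x) : ℤ))| = Nat.find (h' x) := by
        split_ifs <;> simp
      beta_reduce
      rw [this, Int.abs_eq_natAbs]
      exact_mod_cast hle

/-- A map which on each of countably many measurable sets covering the space agrees with a
measurable map is measurable. -/
theorem measurable_of_iUnion_eq {Y ι : Type*} [MeasurableSpace Y] [Countable ι] {f : X → Y}
    (E : ι → Set X) (hE : ∀ i, MeasurableSet (E i)) (hc : ∀ x, ∃ i, x ∈ E i) (g : ι → X → Y)
    (hg : ∀ i, Measurable (g i)) (h : ∀ i, ∀ x ∈ E i, f x = g i x) : Measurable f := by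
  intro A hA
  have : f ⁻¹' A = ⋃ i, E i ∩ g i ⁻¹' A := by
    ext x
    simp only [Set.mem_preimage, Set.mem_iUnion, Set.mem_inter_iff]
    constructor
    · intro hx
      obtain ⟨i, hi⟩ := hc x
      exact ⟨i, hi, h i x hi ▸ hx⟩
    · rintro ⟨i, hi, hx⟩
      rw [h i x hi]; exact hx
  rw [this]
  exact MeasurableSet.iUnion fun i => (hE i).inter (hg i hA)

/-- Elements of the full group of a measure-preserving transformation preserve the measure. -/
theorem measurePreserving_of_mem_orbit [MeasurableEq X] {μ : Measure X} {S φ : X ≃ᵐ X}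
    (hS : MeasurePreserving S μ μ) (h : ∀ x, ∃ k : ℤ, φ x = iter S k x) :
    MeasurePreserving φ μ μ := by
  obtain ⟨f, hf, hfx⟩ := exists_measurable_int (fun k => {x | φ x = iter S k x})
    (fun k => measurableSet_eq_fun φ.measurable (measurable_iter S k)) h
  refine ⟨φ.measurable, Measure.ext fun A hA => ?_⟩
  rw [Measure.map_apply φ.measurable hA]
  set E : ℤ → Set X := fun k => f ⁻¹' {k}
  have hE : ∀ k, MeasurableSet (E k) := fun k => hf (measurableSet_singleton k)
  have hEd : Pairwise (Function.onFun Disjoint E) := by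
    intro i j hij
    refine Set.disjoint_left.2 fun x hx hy => hij ?_
    exact (Set.mem_singleton_iff.1 hx).symm.trans (Set.mem_singleton_iff.1 hy)
  have hEu : ⋃ k, E k = Set.univ := by ext x; simp [E]
  have h1 : μ (φ ⁻¹' A) = ∑' k, μ (φ ⁻¹' A ∩ E k) := by
    rw [← measure_iUnion _ fun k => (φ.measurable hA).inter (hE k), ← Set.inter_iUnion, hEu,
      Set.inter_univ]
    exact fun i j hij => (hEd hij).mono Set.inter_subset_right Set.inter_subset_right
  have h2 : μ A = ∑' k, μ (A ∩ φ '' E k) := by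
    rw [← measure_iUnion _ fun k => hA.inter (φ.measurableSet_image.2 (hE k)),
      ← Set.inter_iUnion, ← Set.image_iUnion, hEu, Set.image_univ, φ.surjective.range_eq,
      Set.inter_univ]
    exact fun i j hij => ((Set.disjoint_image_iff φ.injective).2 (hEd hij)).mono
      Set.inter_subset_right Set.inter_subset_right
  rw [h1, h2]
  refine tsum_congr fun k => ?_
  have : A ∩ φ '' E k = iter S k '' (φ ⁻¹' A ∩ E k) := by
    have hk : ∀ x ∈ E k, φ x = iter S k x := by
      intro x hx
      have := (hfx x).1
      rwa [Set.mem_singleton_iff.1 hx] at this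
    ext y
    constructor
    · rintro ⟨hy, x, hx, rfl⟩
      exact ⟨x, ⟨hy, hx⟩, (hk x hx).symm⟩
    · rintro ⟨x, ⟨hx1, hx2⟩, rfl⟩
      rw [← hk x hx2]
      exact ⟨hx1, x, hx2, rfl⟩
  rw [this, measure_image_iter hS]

end Iterates

/-! ### Subsets of prescribed measure -/

section Atomless

variable {X : Type*} [MeasurableSpace X] [StandardBorelSpace X]
  {μ : Measure X} [IsProbabilityMeasure μ] [NullSingletonClass μ]

/-- The values of an atomless measure fill an interval. -/
theorem exists_subset_measureReal_eq {C : Set X} (hC : MeasurableSet C) {r : ℝ}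
    (h0 : 0 ≤ r) (h1 : r ≤ μ.real C) :
    ∃ D ⊆ C, MeasurableSet D ∧ μ.real D = r := by
  rcases h0.eq_or_lt with rfl | h0
  · exact ⟨∅, C.empty_subset, .empty, by simp⟩
  rcases h1.eq_or_lt with rfl | h1
  · exact ⟨C, subset_rfl, hC, rfl⟩
  obtain ⟨e, he⟩ := exists_measurableEmbedding_real X
  set ν : Measure ℝ := (μ.restrict C).map e with hν
  have hνe : ∀ s : Set ℝ, MeasurableSet s → ν.real s = μ.real (e ⁻¹' s ∩ C) := by
    intro s hs
    rw [measureReal_def, hν, Measure.map_apply he.measurable hs,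
      Measure.restrict_apply (he.measurable hs), measureReal_def]
  have hνu : ν.real Set.univ = μ.real C := by rw [hνe _ .univ]; simp
  have hfin : IsFiniteMeasure ν := by rw [hν]; infer_instance
  have hns : NullSingletonClass ν := by
    refine ⟨fun y => ?_⟩
    rw [hν, Measure.map_apply he.measurable (measurableSet_singleton y)]
    have : (e ⁻¹' {y}).Subsingleton := by
      intro a ha b hb
      exact he.injective ((Set.mem_singleton_iff.1 ha).trans (Set.mem_singleton_iff.1 hb).symm)
    exact le_antisymm ((Measure.restrict_apply_le _ _).trans (this.measure_zero μ).le) zero_le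
  have hcont : Continuous fun b => ν.real (Set.Iic b) := by
    have hc := intervalIntegral.continuous_primitive (μ := ν) (f := fun _ => (1 : ℝ))
      (fun a b => intervalIntegrable_const) 0
    have : (fun b => ν.real (Set.Iic b)) =
        fun b => ν.real (Set.Iic 0) + ∫ _x in (0 : ℝ)..b, (1 : ℝ) ∂ν := by
      ext b
      rw [← intervalIntegral.integral_Iic_sub_Iic (integrable_const _).integrableOn
        (integrable_const _).integrableOn]
      simp
    rw [this]
    exact continuous_const.add hc
  have htop : Tendsto (fun b => ν.real (Set.Iic b)) atTop (𝓝 (ν.real Set.univ)) :=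
    (ENNReal.tendsto_toReal (measure_ne_top ν _)).comp (tendsto_measure_Iic_atTop ν)
  have hbot : Tendsto (fun b => ν.real (Set.Iic b)) atBot (𝓝 0) := by
    have h := (ENNReal.tendsto_toReal (measure_ne_top ν _)).comp (tendsto_measure_Ici_atBot ν)
    have h2 : Tendsto (fun b => ν.real Set.univ - ν.real (Set.Ici b)) atBot (𝓝 0) := by
      simpa [measureReal_def] using (tendsto_const_nhds (x := ν.real Set.univ)).sub h
    refine h2.congr fun b => ?_
    rw [← measureReal_compl measurableSet_Ici, Set.compl_Ici]
    exact measureReal_congr Iio_ae_eq_Iic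
  obtain ⟨a, ha⟩ := (hbot.eventually (gt_mem_nhds h0)).exists
  obtain ⟨b, hb⟩ := (htop.eventually (lt_mem_nhds (hνu ▸ h1))).exists
  obtain ⟨c, hc⟩ := mem_range_of_exists_le_of_exists_ge hcont ⟨a, ha.le⟩ ⟨b, hb.le⟩
  exact ⟨e ⁻¹' Set.Iic c ∩ C, Set.inter_subset_right, (he.measurable measurableSet_Iic).inter hC,
    by rw [← hνe _ measurableSet_Iic]; exact hc⟩

/-- An atomless set can be cut into `M + 1` pieces of equal measure. -/
theorem exists_equidistributed_on (M : ℕ) {C : Set X} (hC : MeasurableSet C) :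
    ∃ t : X → ℕ, Measurable t ∧ (∀ x, t x < M + 1) ∧
      ∀ s < M + 1, μ.real (C ∩ t ⁻¹' {s}) = μ.real C / (M + 1) := by
  induction M generalizing C with
  | zero =>
    refine ⟨fun _ => 0, measurable_const, fun _ => by simp, fun s hs => ?_⟩
    obtain rfl : s = 0 := by omega
    have : (fun _ : X => 0) ⁻¹' {0} = Set.univ := by ext; simp
    rw [this]; simp
  | succ M ih =>
    have hM : (0 : ℝ) < M + 1 := by positivity
    have hle : μ.real C / (M + 1 + 1) ≤ μ.real C :=
      div_le_self measureReal_nonneg (by linarith)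
    obtain ⟨D, hDC, hD, hDm⟩ := exists_subset_measureReal_eq hC (by positivity) hle
    obtain ⟨t, ht, htM, hts⟩ := ih (hC.diff hD)
    classical
    refine ⟨fun x => if x ∈ D then M + 1 else t x, Measurable.ite hD measurable_const ht,
      fun x => ?_, fun s hs => ?_⟩
    · have := htM x
      beta_reduce
      split_ifs <;> omega
    · rcases Nat.lt_succ_iff_lt_or_eq.1 hs with h | rfl
      · have : C ∩ (fun x => if x ∈ D then M + 1 else t x) ⁻¹' {s} = (C \ D) ∩ t ⁻¹' {s} := by
          ext x
          by_cases hx : x ∈ D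
          · simp only [Set.mem_inter_iff, Set.mem_preimage, hx, if_true, Set.mem_singleton_iff,
              Set.mem_sdiff, not_true, and_false, false_and, iff_false, not_and]
            intro _; omega
          · simp [hx]
        rw [this, hts s h, measureReal_sdiff hDC hD, hDm]
        push_cast
        field_simp
        ring
      · have : C ∩ (fun x => if x ∈ D then M + 1 else t x) ⁻¹' {M + 1} = D := by
          ext x
          by_cases hx : x ∈ D
          · simp [hx, hDC hx]
          · have := htM x
            simp only [Set.mem_inter_iff, Set.mem_preimage, hx, if_false, Set.mem_singleton_iff,
              iff_false, not_and]
            intro _; omega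
        rw [this, hDm]
        push_cast; ring

/-- A function with values in `{0, …, M}` that is uniformly distributed and independent of a given
random variable with finitely or countably many values. -/
theorem exists_equidistributed {ι : Type*} (M : ℕ) {n : X → ι} [Countable ι]
    (hn : ∀ v, MeasurableSet (n ⁻¹' {v})) :
    ∃ t : X → ℕ, Measurable t ∧ (∀ x, t x < M + 1) ∧
      ∀ v, ∀ s < M + 1, μ.real (n ⁻¹' {v} ∩ t ⁻¹' {s}) = μ.real (n ⁻¹' {v}) / (M + 1) := by
  choose t ht htM hts using fun v => exists_equidistributed_on (μ := μ) M (hn v)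
  refine ⟨fun x => t (n x) x, ?_, fun x => htM _ _, fun v s hs => ?_⟩
  · exact measurable_of_iUnion_eq (fun v => n ⁻¹' {v}) hn (fun x => ⟨n x, rfl⟩) t ht
      fun v x hx => by rw [Set.mem_singleton_iff.1 hx]
  · rw [← hts v s hs]
    congr 1
    ext x
    simp only [Set.mem_inter_iff, Set.mem_preimage, Set.mem_singleton_iff]
    constructor <;> rintro ⟨rfl, h⟩ <;> exact ⟨rfl, h⟩

end Atomless

/-! ### Weak mixing from mixing along a sequence of times -/

section WeakMixing

variable {X : Type*} [MeasurableSpace X] {μ : Measure X} [IsProbabilityMeasure μ]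

theorem abs_measureReal_sub_le (A B C : Set X) (h : A ⊆ B ∪ C) (h' : B ⊆ A ∪ C) :
    |μ.real A - μ.real B| ≤ μ.real C := by
  have h1 := (measureReal_mono (μ := μ) h).trans (measureReal_union_le _ _)
  have h2 := (measureReal_mono (μ := μ) h').trans (measureReal_union_le _ _)
  rw [abs_le]; constructor <;> linarith

/-- Mixing along a sequence of times needs to be checked only on a dense family of sets. -/
theorem tendsto_measureReal_inter_of_dense {T : X ≃ᵐ X} (hT : MeasurePreserving T μ μ) (l : ℕ → ℤ)
    (D : Set (Set X))
    (hD : ∀ A, MeasurableSet A → ∀ ε : ℝ, 0 < ε → ∃ A' ∈ D, μ.real (symmDiff A A') ≤ ε)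
    (h : ∀ A ∈ D, ∀ B ∈ D, Tendsto (fun n => μ.real (A ∩ iter T (l n) ⁻¹' B)) atTop
      (𝓝 (μ.real A * μ.real B))) {A B : Set X} (hA : MeasurableSet A) (hB : MeasurableSet B) :
    Tendsto (fun n => μ.real (A ∩ iter T (l n) ⁻¹' B)) atTop (𝓝 (μ.real A * μ.real B)) := by
  rw [Metric.tendsto_atTop]
  intro ε hε
  obtain ⟨A', hA'D, hA'⟩ := hD A hA (ε / 5) (by positivity)
  obtain ⟨B', hB'D, hB'⟩ := hD B hB (ε / 5) (by positivity)
  obtain ⟨n₀, hn₀⟩ := Metric.tendsto_atTop.1 (h A' hA'D B' hB'D) (ε / 5) (by positivity)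
  refine ⟨n₀, fun n hn => ?_⟩
  have h1 := hn₀ n hn
  rw [Real.dist_eq] at h1 ⊢
  have h2 : |μ.real (A ∩ iter T (l n) ⁻¹' B) - μ.real (A' ∩ iter T (l n) ⁻¹' B')|
      ≤ ε / 5 + ε / 5 := by
    refine (abs_measureReal_sub_le _ _ (symmDiff A A' ∪ iter T (l n) ⁻¹' symmDiff B B')
      ?_ ?_).trans ?_
    · rintro x ⟨hx1, hx2⟩
      simp only [Set.mem_union, Set.mem_inter_iff, Set.mem_preimage, Set.mem_symmDiff] at *
      tauto
    · rintro x ⟨hx1, hx2⟩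
      simp only [Set.mem_union, Set.mem_inter_iff, Set.mem_preimage, Set.mem_symmDiff] at *
      tauto
    · refine (measureReal_union_le _ _).trans ?_
      rw [measureReal_preimage_iter hT]
      exact add_le_add hA' hB'
  have h3 : |μ.real A - μ.real A'| ≤ ε / 5 := (abs_measureReal_sub_le A A' (symmDiff A A')
    (fun x hx => by simp only [Set.mem_union, Set.mem_symmDiff]; tauto)
    (fun x hx => by simp only [Set.mem_union, Set.mem_symmDiff]; tauto)).trans hA'
  have h4 : |μ.real B - μ.real B'| ≤ ε / 5 := (abs_measureReal_sub_le B B' (symmDiff B B')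
    (fun x hx => by simp only [Set.mem_union, Set.mem_symmDiff]; tauto)
    (fun x hx => by simp only [Set.mem_union, Set.mem_symmDiff]; tauto)).trans hB'
  have h5 : |μ.real A' * μ.real B' - μ.real A * μ.real B| ≤ ε / 5 + ε / 5 := by
    have e : μ.real A' * μ.real B' - μ.real A * μ.real B
        = -((μ.real A - μ.real A') * μ.real B') + -(μ.real A * (μ.real B - μ.real B')) := by ring
    rw [e]
    refine (abs_add_le _ _).trans ?_
    rw [abs_neg, abs_neg, abs_mul, abs_mul, abs_of_nonneg (measureReal_nonneg (s := B')),
      abs_of_nonneg (measureReal_nonneg (s := A))]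
    have hb : μ.real B' ≤ 1 := measureReal_le_one
    have ha : μ.real A ≤ 1 := measureReal_le_one
    refine add_le_add ?_ ?_
    · exact (mul_le_of_le_one_right (abs_nonneg _) hb).trans h3
    · exact (mul_le_of_le_one_left (abs_nonneg _) ha).trans h4
  have e : μ.real (A ∩ iter T (l n) ⁻¹' B) - μ.real A * μ.real B
      = (μ.real (A ∩ iter T (l n) ⁻¹' B) - μ.real (A' ∩ iter T (l n) ⁻¹' B'))
        + (μ.real (A' ∩ iter T (l n) ⁻¹' B') - μ.real A' * μ.real B')
        + (μ.real A' * μ.real B' - μ.real A * μ.real B) := by ring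
  rw [e]
  have := abs_add_three (μ.real (A ∩ iter T (l n) ⁻¹' B) - μ.real (A' ∩ iter T (l n) ⁻¹' B'))
    (μ.real (A' ∩ iter T (l n) ⁻¹' B') - μ.real A' * μ.real B')
    (μ.real A' * μ.real B' - μ.real A * μ.real B)
  linarith

/-- Mixing along a sequence of times implies weak mixing. The times automatically leave every
finite set: for a fixed `g` and a set `A` with `0 < μ A < 1`, the sets `A` and
`T ^ (-g) (T ^ g A)` are not independent. -/
theorem isWeakMixing_of_tendsto [StandardBorelSpace X] [NullSingletonClass μ]
    {T : X ≃ᵐ X} (l : ℕ → ℤ)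
    (h : ∀ A B : Set X, MeasurableSet A → MeasurableSet B →
      Tendsto (fun n => μ.real (A ∩ iter T (l n) ⁻¹' B)) atTop (𝓝 (μ.real A * μ.real B)))
    (hT : MeasurePreserving T μ μ) : IsWeakMixing μ T := by
  have hl : Tendsto (fun n => -l n) atTop cofinite := by
    have hne : ∀ g : ℤ, ∀ᶠ n in atTop, l n ≠ g := by
      intro g
      obtain ⟨A, -, hA, hAm⟩ := exists_subset_measureReal_eq (μ := μ) (C := Set.univ)
        .univ (r := 1 / 2) (by norm_num) (by simp; norm_num)
      have hB : MeasurableSet (iter T (-g) ⁻¹' A) := measurable_iter T _ hA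
      have hBm : μ.real (iter T (-g) ⁻¹' A) = 1 / 2 := by rw [measureReal_preimage_iter hT, hAm]
      have hlim := h A _ hA hB
      rw [hAm, hBm] at hlim
      filter_upwards [hlim.eventually
        (gt_mem_nhds (show (1 / 2 * (1 / 2) : ℝ) < 1 / 2 by norm_num))] with n hn hg
      have : A ∩ iter T (l n) ⁻¹' (iter T (-g) ⁻¹' A) = A := by
        ext x; simp [hg]
      rw [this, hAm] at hn
      exact lt_irrefl _ hn
    refine le_cofinite_iff_eventually_ne.2 fun g => eventually_map.2 ?_
    filter_upwards [hne (-g)] with n hn h'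
    exact hn (by rw [← h']; ring)
  intro F hF
  set u : ℤ → ℝ := fun g => ∑ A ∈ F, ∑ B ∈ F,
      |μ.real (A ∩ iter T g '' B) - μ.real A * μ.real B| with hu
  have hu0 : ∀ g, 0 ≤ u g := fun g =>
    Finset.sum_nonneg fun _ _ => Finset.sum_nonneg fun _ _ => abs_nonneg _
  have hlim : Tendsto (fun n => u (-l n)) atTop (𝓝 0) := by
    have : (0 : ℝ) = ∑ A ∈ F, ∑ B ∈ F, |μ.real A * μ.real B - μ.real A * μ.real B| := by simp
    rw [this]
    refine tendsto_finsetSum _ fun A hA => tendsto_finsetSum _ fun B hB => ?_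
    simp only [image_iter, neg_neg]
    exact ((h A B (hF A hA) (hF B hB)).sub_const _).abs
  have hfreq : ∀ ε : ℝ, 0 < ε → ∃ᶠ g in cofinite, u g ≤ ε := by
    intro ε hε
    refine hl.frequently (p := fun g => u g ≤ ε) (Eventually.frequently ?_)
    filter_upwards [hlim.eventually (gt_mem_nhds hε)] with n hn using hn.le
  apply le_antisymm
  · refine le_of_forall_pos_le_add fun ε hε => ?_
    rw [zero_add]
    exact liminf_le_of_frequently_le (hfreq ε hε) ⟨0, by simp [hu0]⟩
  · exact le_liminf_of_le (IsCoboundedUnder.of_frequently_le (hfreq 1 one_pos))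
      (Eventually.of_forall hu0)

end WeakMixing

/-! ### Limits of actions that are mixing relative to refining partitions -/

section Limit

variable {X : Type*} [MeasurableSpace X] {μ : Measure X} [IsProbabilityMeasure μ]

/-- The union of the atoms of `P` with index in `I`. -/
def atomUnion (P : ℕ → Set X) (I : Set ℕ) : Set X := ⋃ a ∈ I, P a

theorem IsMeasurablePartition.exists_mem {P : ℕ → Set X} (hP : IsMeasurablePartition P) (x : X) :
    ∃ a, x ∈ P a := by
  have : x ∈ ⋃ a, P a := hP.cover ▸ Set.mem_univ x
  simpa using this

theorem IsMeasurablePartition.eq_of_mem {P : ℕ → Set X} (hP : IsMeasurablePartition P) {x : X}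
    {a b : ℕ} (ha : x ∈ P a) (hb : x ∈ P b) : a = b := by
  by_contra hab
  exact Set.disjoint_left.1 (hP.disjoint hab) ha hb

theorem IsMeasurablePartition.measurableSet_atomUnion {P : ℕ → Set X}
    (hP : IsMeasurablePartition P) (I : Set ℕ) : MeasurableSet (atomUnion P I) :=
  .biUnion I.to_countable fun a _ => hP.measurableSet a

theorem IsMeasurablePartition.compl_atomUnion {P : ℕ → Set X}
    (hP : IsMeasurablePartition P) (I : Set ℕ) : (atomUnion P I)ᶜ = atomUnion P Iᶜ := by
  ext x
  obtain ⟨a, ha⟩ := hP.exists_mem x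
  have : ∀ J : Set ℕ, x ∈ atomUnion P J ↔ a ∈ J := by
    intro J
    simp only [atomUnion, Set.mem_iUnion, exists_prop]
    exact ⟨fun ⟨b, hb, hx⟩ => hP.eq_of_mem ha hx ▸ hb, fun h => ⟨a, h, ha⟩⟩
  rw [Set.mem_compl_iff, this, this, Set.mem_compl_iff]

theorem Refines.exists_atomUnion_eq {P Q : ℕ → Set X} (hP : IsMeasurablePartition P)
    (hQ : IsMeasurablePartition Q) (h : Refines Q P) (I : Set ℕ) :
    ∃ J, atomUnion P I = atomUnion Q J := by
  refine ⟨{b | Q b ⊆ atomUnion P I}, Set.Subset.antisymm (fun x hx => ?_) ?_⟩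
  · obtain ⟨b, hb⟩ := hQ.exists_mem x
    refine Set.mem_biUnion (x := b) ?_ hb
    obtain ⟨a, ha⟩ := h b
    obtain ⟨a', ha', hxa'⟩ := Set.mem_iUnion₂.1 hx
    obtain rfl := hP.eq_of_mem hxa' (ha hb)
    exact ha.trans (Set.subset_biUnion_of_mem (u := fun a => P a) ha')
  · exact Set.iUnion₂_subset fun b hb => hb

theorem exists_atomUnion_eq_of_le {P : ℕ → ℕ → Set X} (hP : ∀ n, IsMeasurablePartition (P n))
    (hr : ∀ n, Refines (P (n + 1)) (P n)) {m n : ℕ} (hmn : m ≤ n) (I : Set ℕ) :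
    ∃ J, atomUnion (P m) I = atomUnion (P n) J := by
  induction n, hmn using Nat.le_induction with
  | base => exact ⟨I, rfl⟩
  | succ n _ ih =>
    obtain ⟨J, hJ⟩ := ih
    obtain ⟨K, hK⟩ := (hr n).exists_atomUnion_eq (hP n) (hP (n + 1)) J
    exact ⟨K, hJ.trans hK⟩

/-- The unions of atoms of the partitions in a refining generating sequence form an algebra, and
thus they are dense. -/
theorem exists_atomUnion_measureReal_symmDiff_le {P : ℕ → ℕ → Set X}
    (hP : ∀ n, IsMeasurablePartition (P n)) (hr : ∀ n, Refines (P (n + 1)) (P n))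
    (hg : GeneratesModNull μ P) {A : Set X} (hA : MeasurableSet A) {ε : ℝ} (hε : 0 < ε) :
    ∃ A' ∈ {C | ∃ n I, C = atomUnion (P n) I}, μ.real (symmDiff A A') ≤ ε := by
  set 𝒜 : Set (Set X) := {C | ∃ n I, C = atomUnion (P n) I} with h𝒜
  have halg : IsSetAlgebra 𝒜 := by
    refine ⟨⟨0, ∅, by simp [atomUnion]⟩, ?_, ?_⟩
    · rintro _ ⟨n, I, rfl⟩
      exact ⟨n, Iᶜ, (hP n).compl_atomUnion I⟩
    · rintro _ _ ⟨m, I, rfl⟩ ⟨n, J, rfl⟩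
      obtain ⟨I', hI'⟩ := exists_atomUnion_eq_of_le hP hr (le_max_left m n) I
      obtain ⟨J', hJ'⟩ := exists_atomUnion_eq_of_le hP hr (le_max_right m n) J
      refine ⟨max m n, I' ∪ J', ?_⟩
      rw [hI', hJ', atomUnion, atomUnion, atomUnion, Set.biUnion_union]
  have hle : MeasurableSpace.generateFrom 𝒜 ≤ (inferInstance : MeasurableSpace X) := by
    refine MeasurableSpace.generateFrom_le ?_
    rintro _ ⟨n, I, rfl⟩
    exact (hP n).measurableSet_atomUnion I
  obtain ⟨B, hB, hAB⟩ := hg A hA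
  have hB' : MeasurableSet[MeasurableSpace.generateFrom 𝒜] B := by
    refine MeasurableSpace.generateFrom_mono ?_ B hB
    rintro _ ⟨n, a, rfl⟩
    exact ⟨n, {a}, by simp [atomUnion]⟩
  have hdense := @Measure.MeasureDense.of_generateFrom_isSetAlgebra_finite X
    (MeasurableSpace.generateFrom 𝒜) (μ.trim hle) 𝒜 (isFiniteMeasure_trim hle) halg rfl
  obtain ⟨A', hA', hlt⟩ := @Measure.MeasureDense.approx X (MeasurableSpace.generateFrom 𝒜) _ _
    hdense B hB' (@measure_ne_top _ (MeasurableSpace.generateFrom 𝒜) _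
      (isFiniteMeasure_trim hle) B) ε hε
  refine ⟨A', hA', ?_⟩
  rw [trim_measurableSet_eq hle (hB'.symmDiff
    (MeasurableSpace.measurableSet_generateFrom hA'))] at hlt
  have : symmDiff A A' =ᵐ[μ] symmDiff B A' := hAB.symmDiff (ae_eq_refl _)
  exact (measureReal_congr this).trans_le (ENNReal.toReal_le_of_le_ofReal hε.le hlt.le)

/-- If the joint distribution of `(P, T ^ (-l) P)` is close to the product distribution then so are
the measures of all intersections of unions of atoms. -/
theorem abs_measureReal_atomUnion_inter_le {T : X ≃ᵐ X} {P : ℕ → Set X}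
    (hP : IsMeasurablePartition P) {l : ℤ} {δ : ℝ}
    (h : ∑' a : ℕ, ∑' b : ℕ, ENNReal.ofReal
      |μ.real (P a ∩ iter T l ⁻¹' P b) - μ.real (P a) * μ.real (P b)| ≤ ENNReal.ofReal δ)
    (hδ : 0 ≤ δ) (I J : Set ℕ) :
    |μ.real (atomUnion P I ∩ iter T l ⁻¹' atomUnion P J)
      - μ.real (atomUnion P I) * μ.real (atomUnion P J)| ≤ δ := by
  set m : ℕ × ℕ → ENNReal := fun p => μ (P p.1 ∩ iter T l ⁻¹' P p.2) with hm
  set n : ℕ × ℕ → ENNReal := fun p => μ (P p.1) * μ (P p.2) with hn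
  set d : ℕ × ℕ → ENNReal := fun p => ENNReal.ofReal
    |μ.real (P p.1 ∩ iter T l ⁻¹' P p.2) - μ.real (P p.1) * μ.real (P p.2)| with hd
  have hmn : ∀ p, m p ≤ n p + d p ∧ n p ≤ m p + d p := by
    intro p
    have h1 : m p = ENNReal.ofReal (μ.real (P p.1 ∩ iter T l ⁻¹' P p.2)) := by
      simp [hm]
    have h2 : n p = ENNReal.ofReal (μ.real (P p.1) * μ.real (P p.2)) := by
      rw [ENNReal.ofReal_mul measureReal_nonneg]; simp [hn]
    rw [h1, h2, hd]
    beta_reduce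
    rw [← ENNReal.ofReal_add (by positivity) (by positivity),
      ← ENNReal.ofReal_add (by positivity) (by positivity)]
    constructor
    · apply ENNReal.ofReal_le_ofReal
      linarith [le_abs_self (μ.real (P p.1 ∩ iter T l ⁻¹' P p.2) - μ.real (P p.1) * μ.real (P p.2))]
    · apply ENNReal.ofReal_le_ofReal
      linarith [neg_abs_le (μ.real (P p.1 ∩ iter T l ⁻¹' P p.2)
        - μ.real (P p.1) * μ.real (P p.2))]
  have hunion : ∀ K : Set ℕ, μ (atomUnion P K) = ∑' a : K, μ (P a) := fun K =>
    measure_biUnion K.to_countable (fun a _ b _ hab => hP.disjoint hab)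
      fun a _ => hP.measurableSet a
  have hM : μ (atomUnion P I ∩ iter T l ⁻¹' atomUnion P J) = ∑' p : I × J, m (p.1, p.2) := by
    have e : atomUnion P I ∩ iter T l ⁻¹' atomUnion P J
        = ⋃ p : I × J, P p.1 ∩ iter T l ⁻¹' P p.2 := by
      ext x
      simp only [atomUnion, Set.mem_inter_iff, Set.mem_iUnion, Set.mem_preimage, Prod.exists,
        Subtype.exists, exists_prop]
      constructor
      · rintro ⟨⟨a, ha, hxa⟩, b, hb, hxb⟩
        exact ⟨a, ha, b, hb, hxa, hxb⟩
      · rintro ⟨a, ha, b, hb, hxa, hxb⟩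
        exact ⟨⟨a, ha, hxa⟩, b, hb, hxb⟩
    rw [e, measure_iUnion]
    · rintro ⟨a, b⟩ ⟨a', b'⟩ hne
      refine Set.disjoint_left.2 fun x hx hx' => hne ?_
      exact Prod.ext (Subtype.ext (hP.eq_of_mem hx.1 hx'.1)) (Subtype.ext (hP.eq_of_mem hx.2 hx'.2))
    · exact fun p => (hP.measurableSet _).inter (measurable_iter T l (hP.measurableSet _))
  have hN : μ (atomUnion P I) * μ (atomUnion P J) = ∑' p : I × J, n (p.1, p.2) := by
    rw [hunion, hunion, ENNReal.tsum_prod (f := fun (a : I) (b : J) => n (a, b))]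
    simp only [hn, ENNReal.tsum_mul_left, ENNReal.tsum_mul_right]
  have hD : ∑' p : I × J, d (p.1, p.2) ≤ ENNReal.ofReal δ := by
    have hinj : Function.Injective fun p : I × J => ((p.1 : ℕ), (p.2 : ℕ)) := by
      rintro ⟨a, b⟩ ⟨a', b'⟩ h
      simpa [Subtype.ext_iff] using h
    refine (ENNReal.tsum_comp_le_tsum_of_injective hinj d).trans ?_
    rw [← ENNReal.tsum_prod (f := fun a b => d (a, b))] at h
    exact h
  have h1 : ∑' p : I × J, m (p.1, p.2) ≤ ∑' p : I × J, n (p.1, p.2) + ENNReal.ofReal δ :=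
    ((ENNReal.tsum_le_tsum fun p => (hmn _).1).trans_eq ENNReal.tsum_add).trans
      (add_le_add le_rfl hD)
  have h2 : ∑' p : I × J, n (p.1, p.2) ≤ ∑' p : I × J, m (p.1, p.2) + ENNReal.ofReal δ :=
    ((ENNReal.tsum_le_tsum fun p => (hmn _).2).trans_eq ENNReal.tsum_add).trans
      (add_le_add le_rfl hD)
  rw [← hM, ← hN] at h1 h2
  have hne : μ (atomUnion P I) * μ (atomUnion P J) ≠ ⊤ :=
    ENNReal.mul_ne_top (measure_ne_top _ _) (measure_ne_top _ _)
  have h1' := ENNReal.toReal_mono (ENNReal.add_ne_top.2 ⟨hne, ENNReal.ofReal_ne_top⟩) h1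
  have h2' := ENNReal.toReal_mono
    (ENNReal.add_ne_top.2 ⟨measure_ne_top _ _, ENNReal.ofReal_ne_top⟩) h2
  rw [ENNReal.toReal_add hne ENNReal.ofReal_ne_top, ENNReal.toReal_ofReal hδ,
    ENNReal.toReal_mul] at h1'
  rw [ENNReal.toReal_add (measure_ne_top _ _) ENNReal.ofReal_ne_top, ENNReal.toReal_ofReal hδ,
    ENNReal.toReal_mul] at h2'
  simp only [← measureReal_def] at h1' h2'
  rw [abs_le]; constructor <;> linarith

/-- Relative mixing passes to limits of actions, by Fatou's lemma for sums. Measurability of the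
approximating maps is not needed. -/
theorem tsum_le_of_convergesTo {T : X ≃ᵐ X} {R : ℕ → ℤ → X → X} (hR : ConvergesTo μ R T)
    {P : ℕ → Set X} (hP : IsMeasurablePartition P) {l : ℤ} {δ : ℝ} {k : ℕ → ℕ} (hk : StrictMono k)
    (h : ∀ᶠ j in atTop, IsMixingRel μ (R (k j)) δ l P) :
    ∑' a : ℕ, ∑' b : ℕ, ENNReal.ofReal
      |μ.real (P a ∩ iter T l ⁻¹' P b) - μ.real (P a) * μ.real (P b)| ≤ ENNReal.ofReal δ := by
  rw [← ENNReal.tsum_prod (f := fun a b => ENNReal.ofReal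
    |μ.real (P a ∩ iter T l ⁻¹' P b) - μ.real (P a) * μ.real (P b)|)]
  refine ENNReal.summable.tsum_le_of_sum_le fun s => ?_
  have hlim : ∀ a b, Tendsto (fun j => ENNReal.ofReal
      |μ.real (P a ∩ R (k j) l ⁻¹' P b) - μ.real (P a) * μ.real (P b)|) atTop
      (𝓝 (ENNReal.ofReal |μ.real (P a ∩ iter T l ⁻¹' P b) - μ.real (P a) * μ.real (P b)|)) := by
    intro a b
    refine ENNReal.tendsto_ofReal (Tendsto.abs (Tendsto.sub_const ?_ _))
    rw [tendsto_iff_dist_tendsto_zero]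
    have h0 := (ENNReal.tendsto_toReal ENNReal.zero_ne_top).comp
      ((hR l (P b) (hP.measurableSet b)).comp hk.tendsto_atTop)
    refine squeeze_zero (fun _ => dist_nonneg) (fun j => ?_) h0
    rw [Real.dist_eq]
    refine abs_measureReal_sub_le _ _ _ ?_ ?_
    · rintro x ⟨hx1, hx2⟩
      simp only [Set.mem_union, Set.mem_inter_iff, Set.mem_symmDiff]; tauto
    · rintro x ⟨hx1, hx2⟩
      simp only [Set.mem_union, Set.mem_inter_iff, Set.mem_symmDiff]; tauto
  refine le_of_tendsto (tendsto_finsetSum s fun p _ => hlim p.1 p.2) ?_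
  filter_upwards [h] with j hj
  refine le_trans ?_ hj.le
  rw [← ENNReal.tsum_prod (f := fun a b => ENNReal.ofReal
    |μ.real (P a ∩ R (k j) l ⁻¹' P b) - μ.real (P a) * μ.real (P b)|)]
  exact ENNReal.sum_le_tsum s

/-- A limit of actions that are mixing relative to refining generating partitions is weak
mixing. -/
theorem isWeakMixing_of_convergesTo [StandardBorelSpace X] [NullSingletonClass μ] {T : X ≃ᵐ X}
    (hT : MeasurePreserving T μ μ) {R : ℕ → ℤ → X → X} (hR : ConvergesTo μ R T)
    {l : ℕ → ℤ} {δ : ℕ → ℝ} {P : ℕ → ℕ → Set X} {k : ℕ → ℕ} (hδ : Tendsto δ atTop (𝓝 0))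
    (hP : ∀ n, IsMeasurablePartition (P n)) (hr : ∀ n, Refines (P (n + 1)) (P n))
    (hg : GeneratesModNull μ P) (hk : StrictMono k)
    (h : ∀ i j : ℕ, i ≤ j → IsMixingRel μ (R (k j)) (δ i) (l i) (P i)) :
    IsWeakMixing μ T := by
  have hpos : ∀ i, 0 ≤ δ i := fun i =>
    (ENNReal.ofReal_pos.1 ((zero_le).trans_lt (h i i le_rfl))).le
  refine isWeakMixing_of_tendsto l (fun A B hA hB => tendsto_measureReal_inter_of_dense hT l
    {C | ∃ n I, C = atomUnion (P n) I}
    (fun A hA ε hε => exists_atomUnion_measureReal_symmDiff_le hP hr hg hA hε) ?_ hA hB) hT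
  rintro _ ⟨m, I, rfl⟩ _ ⟨n, J, rfl⟩
  rw [tendsto_iff_dist_tendsto_zero]
  refine squeeze_zero' (Eventually.of_forall fun _ => dist_nonneg) ?_ hδ
  filter_upwards [eventually_ge_atTop (max m n)] with i hi
  obtain ⟨I', hI'⟩ := exists_atomUnion_eq_of_le hP hr ((le_max_left m n).trans hi) I
  obtain ⟨J', hJ'⟩ := exists_atomUnion_eq_of_le hP hr ((le_max_right m n).trans hi) J
  rw [hI', hJ', Real.dist_eq]
  exact abs_measureReal_atomUnion_inter_le (hP i)
    (tsum_le_of_convergesTo hR (hP i) hk ((eventually_ge_atTop i).mono fun j hj => h i j hj))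
    (hpos i) I' J'

end Limit

/-! ### The Rokhlin lemma and freeness -/

section Rokhlin

variable {X : Type*} [MeasurableSpace X] {μ : Measure X} [IsProbabilityMeasure μ]

theorem ae_exists_iter_mem {T : X ≃ᵐ X} (hT : Ergodic T μ) {A : Set X} (hA : MeasurableSet A)
    (h : μ A ≠ 0) : ∀ᵐ x ∂μ, ∃ n : ℕ, iter T n x ∈ A := by
  set C : Set X := ⋃ n : ℕ, iter T n ⁻¹' A with hC
  have hCm : MeasurableSet C := .iUnion fun n => measurable_iter T n hA
  have hsub : T ⁻¹' C ⊆ C := by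
    intro x hx
    obtain ⟨n, hn⟩ := Set.mem_iUnion.1 hx
    refine Set.mem_iUnion.2 ⟨n + 1, ?_⟩
    rw [Set.mem_preimage] at hn ⊢
    rwa [Nat.cast_succ, iter_add, iter_one]
  rcases hT.ae_empty_or_univ_of_preimage_ae_le hCm.nullMeasurableSet hsub.eventuallyLE with h0 | h1
  · refine absurd (measure_mono_null ?_ (ae_eq_empty.1 h0)) h
    exact fun x hx => Set.mem_iUnion.2 ⟨0, hx⟩
  · filter_upwards [eventuallyEq_univ.1 h1] with x hx
    simpa [hC] using hx

variable [StandardBorelSpace X] [NullSingletonClass μ]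

/-- The Rokhlin lemma: the sets `T ^ i B` with `i < N` are disjoint and almost cover the space.
The base consists of the points whose time of first visit to a small set is a positive multiple
of `N`. -/
theorem exists_rokhlin_tower {T : X ≃ᵐ X} (hT : Ergodic T μ) {N : ℕ} (hN : 0 < N)
    {ε : ℝ} (hε : 0 < ε) :
    ∃ B, MeasurableSet B ∧
      (∀ b ∈ B, ∀ b' ∈ B, ∀ i < N, ∀ j < N, iter T (i : ℕ) b = iter T (j : ℕ) b' → i = j) ∧
      μ.real (⋃ i < N, iter T (i : ℕ) '' B)ᶜ ≤ ε := by
  have hN' : (0 : ℝ) < N := by exact_mod_cast hN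
  obtain ⟨A, -, hA, hAm⟩ := exists_subset_measureReal_eq (μ := μ) (C := Set.univ)
    .univ (r := min (ε / N) 1) (by positivity) (by simp)
  set B : Set X := {x | ∃ m : ℕ, iter T ((m + 1) * N : ℕ) x ∈ A ∧
    ∀ k < (m + 1) * N, iter T (k : ℕ) x ∉ A} with hB
  have hfirst : ∀ (x : X) (m n : ℕ), iter T m x ∈ A → (∀ k < m, iter T (k : ℕ) x ∉ A) →
      iter T n x ∈ A → (∀ k < n, iter T (k : ℕ) x ∉ A) → m = n := by
    intro x m n hm hm' hn hn'
    rcases lt_trichotomy m n with h | h | h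
    · exact absurd hm (hn' m h)
    · exact h
    · exact absurd hn (hm' n h)
  have hlt : ∀ b ∈ B, ∀ b' ∈ B, ∀ i j : ℕ, i < j → j < N → iter T i b ≠ iter T j b' := by
    rintro b ⟨m, hm, hm'⟩ b' ⟨m', hm₁, hm₁'⟩ i j hij hj hbb
    have hbb' : b = iter T (j - i : ℕ) b' := by
      apply iter_injective T i
      rw [hbb, ← iter_add]
      congr 1
      push_cast [Nat.cast_sub hij.le]; ring
    have hle : j - i ≤ (m' + 1) * N := by nlinarith [Nat.sub_le j i]
    have : (m + 1) * N = (m' + 1) * N - (j - i) := by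
      apply hfirst b _ _ hm hm'
      · rw [hbb', ← iter_add, ← Nat.cast_add, Nat.sub_add_cancel hle]; exact hm₁
      · intro k hk
        rw [hbb', ← iter_add, ← Nat.cast_add]
        exact hm₁' _ (by omega)
    have hdvd : N ∣ j - i := by
      have h2 : (m + 1) * N + (j - i) = (m' + 1) * N := by omega
      exact (Nat.dvd_add_right (Dvd.intro_left _ rfl)).1 (h2 ▸ Dvd.intro_left _ rfl)
    have := Nat.le_of_dvd (by omega) hdvd
    omega
  refine ⟨B, ?_, ?_, ?_⟩
  · have : B = ⋃ m : ℕ, (iter T ((m + 1) * N : ℕ) ⁻¹' A ∩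
        ⋂ k : ℕ, ⋂ _ : k < (m + 1) * N, (iter T (k : ℕ) ⁻¹' A)ᶜ) := by
      ext x; simp [hB]
    rw [this]
    exact .iUnion fun m => (measurable_iter T _ hA).inter
      (.iInter fun k => .iInter fun _ => (measurable_iter T _ hA).compl)
  · intro b hb b' hb' i hi j hj hij
    rcases lt_trichotomy i j with h | h | h
    · exact absurd hij (hlt b hb b' hb' i j h hj)
    · exact h
    · exact absurd hij.symm (hlt b' hb' b hb j i h hi)
  · have hA0 : μ A ≠ 0 := by
      intro h0
      have : (0 : ℝ) < min (ε / N) 1 := by positivity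
      rw [← hAm, measureReal_def, h0] at this
      simp at this
    have hhit := ae_exists_iter_mem hT hA hA0
    have hcov : (⋃ i < N, iter T (i : ℕ) '' B)ᶜ ⊆
        (⋃ j ∈ Finset.range N, iter T (j : ℕ) '' A) ∪ {x | ¬ ∃ n : ℕ, iter T n x ∈ A} := by
      intro y hy
      by_contra hcon
      have hna : ∀ j < N, y ∉ iter T (j : ℕ) '' A := fun j hj hy => hcon
        (.inl (Set.mem_biUnion (Finset.mem_coe.2 (Finset.mem_range.2 hj)) hy))
      have hex : ∃ n : ℕ, iter T n y ∈ A := by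
        by_contra hne
        exact hcon (.inr hne)
      classical
      set r := Nat.find hex with hr
      have hr1 : iter T r y ∈ A := Nat.find_spec hex
      have hr2 : ∀ k < r, iter T (k : ℕ) y ∉ A := fun k hk => Nat.find_min hex hk
      have hr0 : r ≠ 0 := by
        intro h0
        rw [h0] at hr1
        exact hna 0 hN ⟨y, hr1, rfl⟩
      obtain ⟨i, m, hi, him⟩ : ∃ i m : ℕ, i < N ∧ r + i = (m + 1) * N := by
        refine ⟨N - 1 - (r - 1) % N, (r - 1) / N, by omega, ?_⟩
        have h1 := Nat.div_add_mod (r - 1) N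
        have h2 := Nat.mod_lt (r - 1) hN
        rw [add_mul, one_mul, mul_comm]
        omega
      refine hy (Set.mem_iUnion₂.2 ⟨i, hi, iter T (-(i : ℕ) : ℤ) y, ⟨m, ?_, ?_⟩, by simp⟩)
      · rw [← him, ← iter_add]
        convert hr1 using 2
        push_cast; ring
      · intro k hk
        rw [← iter_add]
        rcases lt_or_ge k i with h | h
        · intro hmem
          refine hna (i - k) (by omega) ⟨_, hmem, ?_⟩
          rw [← iter_add]
          have : ((i - k : ℕ) : ℤ) + (k + -(i : ℕ) : ℤ) = 0 := by omega
          rw [this, iter_zero]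
        · have : (k + -(i : ℕ) : ℤ) = ((k - i : ℕ) : ℤ) := by omega
          rw [this]
          exact hr2 _ (by omega)
    calc μ.real (⋃ i < N, iter T (i : ℕ) '' B)ᶜ
        ≤ μ.real ((⋃ j ∈ Finset.range N, iter T (j : ℕ) '' A) ∪
            {x | ¬ ∃ n : ℕ, iter T n x ∈ A}) := measureReal_mono hcov
      _ ≤ μ.real (⋃ j ∈ Finset.range N, iter T (j : ℕ) '' A) + 0 := by
          refine (measureReal_union_le _ _).trans (add_le_add le_rfl ?_)
          rw [measureReal_def, ae_iff.1 hhit]; simp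
      _ ≤ ∑ j ∈ Finset.range N, μ.real (iter T (j : ℕ) '' A) + 0 := by
          gcongr
          exact measureReal_biUnion_finset_le _ _
      _ = N * min (ε / N) 1 := by
          simp [measureReal_def, measure_image_iter hT.toMeasurePreserving]
          rw [← measureReal_def, hAm]
          simp
      _ ≤ ε := by
          have : min (ε / N) 1 ≤ ε / N := min_le_left _ _
          calc (N : ℝ) * min (ε / N) 1 ≤ N * (ε / N) := by gcongr
            _ = ε := by field_simp

/-- Ergodic transformations of atomless spaces act freely, as the points of period `g` lie outside
every Rokhlin tower of height greater than `g`. -/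
theorem isFree_of_ergodic {T : X ≃ᵐ X} (hT : Ergodic T μ) : IsFree μ T := by
  have key : ∀ n : ℕ, μ {x | iter T (n + 1 : ℕ) x = x} = 0 := by
    intro n
    set E := {x | iter T (n + 1 : ℕ) x = x} with hE
    have hle : ∀ ε : ℝ, 0 < ε → μ.real E ≤ ε := by
      intro ε hε
      obtain ⟨B, hB, hdis, hm⟩ := exists_rokhlin_tower hT (N := n + 2) (by omega) hε
      refine (measureReal_mono ?_).trans hm
      intro x hx hx'
      obtain ⟨i, hi, b, hb, rfl⟩ := Set.mem_iUnion₂.1 hx'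
      have : iter T (n + 1 : ℕ) b = b := by
        apply iter_injective T i
        rw [← iter_add, add_comm, iter_add]
        exact hx
      have := hdis b hb b hb (n + 1) (by omega) 0 (by omega) this
      omega
    have : μ.real E = 0 := le_antisymm (le_of_forall_pos_le_add fun ε hε => by
      simpa using hle ε hε) measureReal_nonneg
    simpa [measureReal_def, ENNReal.toReal_eq_zero_iff] using this
  have h : ∀ᵐ x ∂μ, ∀ n : ℕ, iter T (n + 1 : ℕ) x ≠ x :=
    ae_all_iff.2 fun n => by simpa [ae_iff] using key n
  filter_upwards [h] with x hx g hg hgx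
  obtain ⟨n, rfl | rfl⟩ := g.eq_nat_or_neg
  · obtain _ | n := n
    · simp at hg
    · exact hx n hgx
  · obtain _ | n := n
    · simp at hg
    · apply hx n
      conv_lhs => rw [← hgx]
      exact iter_apply_iter_neg _ _ _

end Rokhlin

/-! ### The mean ergodic theorem for sets -/

section MeanErgodic

variable {X : Type*} [MeasurableSpace X] {μ : Measure X} [IsProbabilityMeasure μ]

/-- The relative number of `t < n` with `T ^ t x ∈ A`. -/
def visitFreq (T : X ≃ᵐ X) (A : Set X) (n : ℕ) (x : X) : ℝ :=
  (n : ℝ)⁻¹ * ∑ t ∈ Finset.range n, A.indicator (fun _ => (1 : ℝ)) (iter T (t : ℕ) x)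

theorem measurable_visitFreq (T : X ≃ᵐ X) {A : Set X} (hA : MeasurableSet A) (n : ℕ) :
    Measurable (visitFreq T A n) := by
  refine Measurable.const_mul (Finset.measurable_fun_sum _ fun t _ => ?_) _
  exact (measurable_const.indicator hA).comp (measurable_iter T t)

theorem visitFreq_nonneg (T : X ≃ᵐ X) (A : Set X) (n : ℕ) (x : X) : 0 ≤ visitFreq T A n x :=
  mul_nonneg (by positivity) (Finset.sum_nonneg fun _ _ =>
    Set.indicator_nonneg (fun _ _ => zero_le_one) _)

theorem visitFreq_le_one (T : X ≃ᵐ X) (A : Set X) (n : ℕ) (x : X) : visitFreq T A n x ≤ 1 := by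
  rcases n.eq_zero_or_pos with rfl | hn
  · simp [visitFreq]
  · have : ∑ t ∈ Finset.range n, A.indicator (fun _ => (1 : ℝ)) (iter T (t : ℕ) x) ≤ n := by
      refine (Finset.sum_le_card_nsmul _ _ 1 fun t _ => ?_).trans (by simp)
      exact Set.indicator_le_self' (fun _ _ => zero_le_one) _
    rw [visitFreq, inv_mul_le_iff₀ (by exact_mod_cast hn)]
    simpa using this

/-- The mean ergodic theorem in `L¹` for an indicator function, deduced from von Neumann's theorem
in `L²`. The integral of the averages identifies the constant limit. -/
theorem tendsto_integral_abs_visitFreq_sub {T : X ≃ᵐ X} (hT : Ergodic T μ) {A : Set X}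
    (hA : MeasurableSet A) :
    Tendsto (fun n => ∫ x, |visitFreq T A n x - μ.real A| ∂μ) atTop (𝓝 0) := by
  set U := Lp.compMeasurePreservingₗᵢ (E := ℝ) (p := 2) ℝ T hT.toMeasurePreserving
  have hU : ∀ v : Lp ℝ 2 μ, U v =ᵐ[μ] v ∘ T := fun v =>
    Lp.coeFn_compMeasurePreserving v hT.toMeasurePreserving
  set f : Lp ℝ 2 μ := indicatorConstLp 2 hA (measure_ne_top _ _) (1 : ℝ) with hf
  have hlim := ContinuousLinearMap.tendsto_birkhoffAverage_orthogonalProjection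
    (U.toContinuousLinearMap) U.norm_toContinuousLinearMap_le f
  generalize hp : (((U.toContinuousLinearMap : Lp ℝ 2 μ →ₗ[ℝ] Lp ℝ 2 μ).eqLocus
    ((1 : Lp ℝ 2 μ →L[ℝ] Lp ℝ 2 μ) : Lp ℝ 2 μ →ₗ[ℝ] Lp ℝ 2 μ)).orthogonalProjectionOnto f) = p
    at hlim
  obtain ⟨g, hg⟩ := p
  have hgU : U g = g := hg
  obtain ⟨c, hc⟩ : ∃ c : ℝ, g =ᵐ[μ] Function.const X c := by
    refine hT.ae_eq_const_of_ae_eq_comp_ae (Lp.aestronglyMeasurable g) ?_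
    exact (hU g).symm.trans (by rw [hgU])
  have hiter : ∀ k : ℕ, (U^[k] f : Lp ℝ 2 μ) =ᵐ[μ]
      fun x => A.indicator (fun _ => (1 : ℝ)) (iter T k x) := by
    intro k
    induction k with
    | zero => simpa using indicatorConstLp_coeFn
    | succ k ih =>
      rw [Function.iterate_succ_apply']
      refine (hU _).trans ?_
      filter_upwards [hT.toMeasurePreserving.quasiMeasurePreserving.ae_eq_comp ih] with x hx
      rw [hx, Nat.cast_succ, iter_add, iter_one]; rfl
  have havg : ∀ n : ℕ, (birkhoffAverage ℝ U id n f : Lp ℝ 2 μ) =ᵐ[μ] visitFreq T A n := by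
    intro n
    have hsum : (birkhoffSum U id n f : Lp ℝ 2 μ) =ᵐ[μ] fun x =>
        ∑ t ∈ Finset.range n, A.indicator (fun _ => (1 : ℝ)) (iter T (t : ℕ) x) := by
      induction n with
      | zero => exact (Lp.coeFn_zero ℝ 2 μ).trans (by simp; rfl)
      | succ n ih =>
        rw [birkhoffSum_succ]
        refine (Lp.coeFn_add _ _).trans ?_
        filter_upwards [ih, hiter n] with x hx hx'
        rw [Pi.add_apply, hx, id, hx', Finset.sum_range_succ]
    refine (Lp.coeFn_smul _ _).trans ?_
    filter_upwards [hsum] with x hx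
    rw [Pi.smul_apply, hx, visitFreq, smul_eq_mul]
  have hbound : ∀ n : ℕ, n ≠ 0 → ∫ x, |visitFreq T A n x - μ.real A| ∂μ
      ≤ 2 * ‖birkhoffAverage ℝ U id n f - g‖ := by
    intro n hn
    have hint : Integrable (visitFreq T A n) μ :=
      Integrable.of_bound (measurable_visitFreq T hA n).aestronglyMeasurable 1
        (.of_forall fun x => by
          rw [Real.norm_eq_abs, abs_of_nonneg (visitFreq_nonneg T A n x)]
          exact visitFreq_le_one T A n x)
    have hint' : Integrable (fun x => |visitFreq T A n x - c|) μ :=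
      (hint.sub (integrable_const c)).abs
    have h1 : ∫ x, |visitFreq T A n x - c| ∂μ ≤ ‖birkhoffAverage ℝ U id n f - g‖ := by
      have : (fun x => |visitFreq T A n x - c|) =ᵐ[μ]
          fun x => ‖(birkhoffAverage ℝ U id n f - g : Lp ℝ 2 μ) x‖ := by
        filter_upwards [havg n, hc, Lp.coeFn_sub (birkhoffAverage ℝ U id n f) g] with x h1 h2 h3
        rw [h3, Pi.sub_apply, h1, h2, Real.norm_eq_abs, Function.const_apply]
      rw [integral_congr_ae this, integral_norm_eq_lintegral_enorm (Lp.aestronglyMeasurable _),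
        ← eLpNorm_one_eq_lintegral_enorm, Lp.norm_def]
      exact ENNReal.toReal_mono (Lp.eLpNorm_ne_top _)
        (eLpNorm_le_eLpNorm_of_exponent_le (by norm_num) (Lp.aestronglyMeasurable _))
    have h2 : ∫ x, visitFreq T A n x ∂μ = μ.real A := by
      unfold visitFreq
      rw [integral_const_mul, integral_finsetSum]
      · have : ∀ t : ℕ, ∫ x, A.indicator (fun _ => (1 : ℝ)) (iter T t x) ∂μ = μ.real A := by
          intro t
          rw [(measurePreserving_iter hT.toMeasurePreserving t).integral_comp
            (measurableEmbedding_iter T t), integral_indicator_const _ hA]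
          simp
        simp only [this, Finset.sum_const, Finset.card_range, nsmul_eq_mul]
        field_simp
      · intro t _
        exact (measurePreserving_iter hT.toMeasurePreserving t).integrable_comp_of_integrable
          ((integrable_const _).indicator hA)
    have h3 : |c - μ.real A| ≤ ∫ x, |visitFreq T A n x - c| ∂μ := by
      have : ∫ x, (visitFreq T A n x - c) ∂μ = μ.real A - c := by
        rw [integral_sub hint (integrable_const _), h2]; simp
      rw [abs_sub_comm, ← this]
      exact abs_integral_le_integral_abs
    calc ∫ x, |visitFreq T A n x - μ.real A| ∂μ
        ≤ ∫ x, (|visitFreq T A n x - c| + |c - μ.real A|) ∂μ := by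
          refine integral_mono (hint.sub (integrable_const _)).abs
            (hint'.add (integrable_const _)) fun x => ?_
          exact abs_sub_le _ _ _
      _ = ∫ x, |visitFreq T A n x - c| ∂μ + |c - μ.real A| := by
          rw [integral_add hint' (integrable_const _)]; simp
      _ ≤ 2 * ‖birkhoffAverage ℝ U id n f - g‖ := by linarith
  have hzero : Tendsto (fun n => 2 * ‖birkhoffAverage ℝ U id n f - g‖) atTop (𝓝 0) := by
    have h := (tendsto_iff_norm_sub_tendsto_zero.1 hlim).const_mul 2
    rw [mul_zero] at h
    exact h
  refine squeeze_zero' (.of_forall fun n => integral_nonneg fun x => abs_nonneg _) ?_ hzero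
  filter_upwards [eventually_ne_atTop 0] with n hn using hbound n hn

end MeanErgodic

/-! ### Permuting the levels of a tower -/

/-- A permutation of `{0, …, N - 1}` which places `K` runs of length `h`, separated by gaps of
length `t`, one after another: position `p` of the new order holds the old index
`p + t * (p / h)`. The order of the remaining indices does not matter. -/
theorem exists_perm_skip {K h t N : ℕ} (hN : K * (h + t) ≤ N) :
    ∃ σ : Equiv.Perm (Fin N), ∀ p : Fin N, (p : ℕ) < K * h → (σ p : ℕ) = p + t * (p / h) := by
  classical
  have hmono : StrictMono fun p : ℕ => p + t * (p / h) := by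
    intro p q hpq
    exact add_lt_add_of_lt_of_le hpq (Nat.mul_le_mul_left t (Nat.div_le_div_right hpq.le))
  have hsub : Finset.image (fun p : Fin N => (p : ℕ) + t * (p / h))
      (Finset.univ.filter fun p : Fin N => (p : ℕ) < K * h) ⊆ Finset.range N := by
    intro q hq
    simp only [Finset.mem_image, Finset.mem_filter, Finset.mem_univ, true_and] at hq
    obtain ⟨p, hp, rfl⟩ := hq
    have h1 : (p : ℕ) / h ≤ K := Nat.div_le_of_le_mul (by rw [mul_comm]; exact hp.le)
    have h2 : t * (p / h) ≤ t * K := Nat.mul_le_mul_left t h1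
    have h3 : K * (h + t) = K * h + t * K := by ring
    rw [Finset.mem_range]
    omega
  obtain ⟨g, hg⟩ := Finset.exists_equiv_extend_of_card_eq (α := Fin N) (t := Finset.range N)
    (by simp) hsub (fun p _ q _ hpq => Fin.ext (hmono.injective hpq))
  have hinj : Function.Injective fun p : Fin N => (⟨g p, Finset.mem_range.1 (g p).2⟩ : Fin N) := by
    intro p q hpq
    exact g.injective (Subtype.ext (by simpa using hpq))
  refine ⟨Equiv.ofBijective _ (Finite.injective_iff_bijective.1 hinj), fun p hp => ?_⟩
  exact hg p (by simpa using hp)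

section Tower

variable {X : Type*} [MeasurableSpace X]

/-- The sets `T ^ i B` with `i < N` are pairwise disjoint. -/
def IsTowerBase (T : X ≃ᵐ X) (N : ℕ) (B : Set X) : Prop :=
  ∀ b ∈ B, ∀ b' ∈ B, ∀ i < N, ∀ j < N, iter T (i : ℕ) b = iter T (j : ℕ) b' → i = j

/-- The union of the levels `T ^ i B` with `i < N`. -/
def tower (T : X ≃ᵐ X) (N : ℕ) (B : Set X) : Set X := ⋃ i < N, iter T (i : ℕ) '' B

theorem mem_tower {T : X ≃ᵐ X} {N : ℕ} {B : Set X} {x : X} :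
    x ∈ tower T N B ↔ ∃ i < N, ∃ b ∈ B, iter T (i : ℕ) b = x := by
  simp [tower]

theorem measurableSet_level {T : X ≃ᵐ X} {B : Set X} (hB : MeasurableSet B) (i : ℤ) :
    MeasurableSet (iter T i '' B) := by
  rw [image_iter]; exact measurable_iter T _ hB

theorem measurableSet_tower {T : X ≃ᵐ X} {N : ℕ} {B : Set X} (hB : MeasurableSet B) :
    MeasurableSet (tower T N B) :=
  .iUnion fun i => .iUnion fun _ => measurableSet_level hB i

theorem IsTowerBase.eq_and_eq {T : X ≃ᵐ X} {N : ℕ} {B : Set X} (h : IsTowerBase T N B)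
    {b b' : X} (hb : b ∈ B) (hb' : b' ∈ B) {i j : ℕ} (hi : i < N) (hj : j < N)
    (he : iter T (i : ℕ) b = iter T (j : ℕ) b') : i = j ∧ b = b' := by
  obtain rfl := h b hb b' hb' i hi j hj he
  exact ⟨rfl, iter_injective T _ he⟩

theorem IsTowerBase.mul_measureReal_le {μ : Measure X} [IsProbabilityMeasure μ] {T : X ≃ᵐ X}
    (hT : MeasurePreserving T μ μ) {N : ℕ} {B : Set X} (h : IsTowerBase T N B)
    (hB : MeasurableSet B) : N * μ.real B ≤ 1 := by
  have h1 : μ.real (⋃ i ∈ Finset.range N, iter T (i : ℕ) '' B)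
      = ∑ i ∈ Finset.range N, μ.real (iter T (i : ℕ) '' B) := by
    refine measureReal_biUnion_finset ?_ fun i _ => measurableSet_level hB i
    intro i hi j hj hij
    refine Set.disjoint_left.2 ?_
    rintro _ ⟨b, hb, rfl⟩ ⟨b', hb', he⟩
    exact hij (h b hb b' hb' i (by simpa using hi) j (by simpa using hj) he.symm)
  have h2 : ∀ i : ℤ, μ.real (iter T i '' B) = μ.real B := fun i => by
    rw [measureReal_def, measure_image_iter hT, measureReal_def]
  simp only [h2, Finset.sum_const, Finset.card_range, nsmul_eq_mul] at h1
  rw [← h1]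
  exact measureReal_le_one

/-- The map that permutes the levels of a tower, over the base point `b` by the permutation
`σ (t b)`, and fixes the points outside. -/
theorem exists_tower_map {T : X ≃ᵐ X} {N : ℕ} {B : Set X} (h : IsTowerBase T N B)
    (hB : MeasurableSet B) (σ : ℕ → Equiv.Perm (Fin N)) {t : X → ℕ} (ht : Measurable t) :
    ∃ f : X → X, Measurable f ∧
      (∀ b ∈ B, ∀ p : Fin N, f (iter T (p : ℕ) b) = iter T (σ (t b) p : ℕ) b) ∧
      ∀ x ∉ tower T N B, f x = x := by
  classical
  set f : X → X := fun x => if hx : ∃ q : Fin N × X, q.2 ∈ B ∧ iter T (q.1 : ℕ) q.2 = x then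
    iter T (σ (t hx.choose.2) hx.choose.1 : ℕ) hx.choose.2 else x with hf
  have h1 : ∀ b ∈ B, ∀ p : Fin N, f (iter T (p : ℕ) b) = iter T (σ (t b) p : ℕ) b := by
    intro b hb p
    have hx : ∃ q : Fin N × X, q.2 ∈ B ∧ iter T (q.1 : ℕ) q.2 = iter T (p : ℕ) b :=
      ⟨(p, b), hb, rfl⟩
    obtain ⟨e1, e2⟩ := h.eq_and_eq hx.choose_spec.1 hb hx.choose.1.2 p.2 hx.choose_spec.2
    rw [hf]
    beta_reduce
    rw [dif_pos hx, e2, Fin.ext e1]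
  have h2 : ∀ x ∉ tower T N B, f x = x := by
    intro x hx
    refine dif_neg ?_
    rintro ⟨⟨p, b⟩, hb, he⟩
    exact hx (mem_tower.2 ⟨p, p.2, b, hb, he⟩)
  refine ⟨f, ?_, h1, h2⟩
  let E : Option (Fin N × ℕ) → Set X := fun q => q.elim (tower T N B)ᶜ
    fun q => iter T (q.1 : ℕ) '' (B ∩ t ⁻¹' {q.2})
  refine measurable_of_iUnion_eq E ?_ ?_
    (fun q => q.elim id fun q => iter T ((σ q.2 q.1 : ℕ) - (q.1 : ℕ) : ℤ)) ?_ ?_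
  · rintro (_ | q)
    · exact (measurableSet_tower hB).compl
    · exact measurableSet_level (hB.inter (ht (measurableSet_singleton _))) _
  · intro x
    by_cases hx : x ∈ tower T N B
    · obtain ⟨i, hi, b, hb, rfl⟩ := mem_tower.1 hx
      exact ⟨some (⟨i, hi⟩, t b), b, ⟨hb, rfl⟩, rfl⟩
    · exact ⟨none, hx⟩
  · rintro (_ | q)
    · exact measurable_id
    · exact measurable_iter T _
  · rintro (_ | ⟨p, s⟩) x hx
    · exact h2 x hx
    · obtain ⟨b, ⟨hb, hbs⟩, rfl⟩ := hx
      have hbs : t b = s := hbs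
      simp only [h1 b hb p, hbs, Option.elim]
      rw [← iter_add, sub_add_cancel]

theorem exists_tower_equiv {T : X ≃ᵐ X} {N : ℕ} {B : Set X} (h : IsTowerBase T N B)
    (hB : MeasurableSet B) (σ : ℕ → Equiv.Perm (Fin N)) {t : X → ℕ} (ht : Measurable t) :
    ∃ φ : X ≃ᵐ X,
      (∀ b ∈ B, ∀ p : Fin N, φ (iter T (p : ℕ) b) = iter T (σ (t b) p : ℕ) b) ∧
      ∀ x ∉ tower T N B, φ x = x := by
  obtain ⟨f, hf, hf1, hf2⟩ := exists_tower_map h hB σ ht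
  obtain ⟨g, hg, hg1, hg2⟩ := exists_tower_map h hB (fun s => (σ s)⁻¹) ht
  refine ⟨⟨⟨f, g, fun x => ?_, fun x => ?_⟩, hf, hg⟩, hf1, hf2⟩
  · by_cases hx : x ∈ tower T N B
    · obtain ⟨i, hi, b, hb, rfl⟩ := mem_tower.1 hx
      have := hf1 b hb ⟨i, hi⟩
      rw [this, hg1 b hb]; simp
    · rw [hf2 x hx, hg2 x hx]
  · by_cases hx : x ∈ tower T N B
    · obtain ⟨i, hi, b, hb, rfl⟩ := mem_tower.1 hx
      have := hg1 b hb ⟨i, hi⟩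
      rw [this, hf1 b hb]; simp
    · rw [hg2 x hx, hf2 x hx]

/-- If `φ` moves points at most `N` steps along their `T`-orbits, then `T` and `φ T φ⁻¹` move
points at most `2 N + 1` steps along each other's orbits. -/
theorem exists_iter_conj {T φ : X ≃ᵐ X} {N : ℕ}
    (hφ : ∀ x, ∃ k : ℤ, |k| ≤ N ∧ φ x = iter T k x) (x : X) :
    (∃ k : ℤ, |k| ≤ (2 * N + 1 : ℕ) ∧ conj φ T x = iter T k x) ∧
      ∃ k : ℤ, |k| ≤ (2 * N + 1 : ℕ) ∧ T x = iter (conj φ T) k x := by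
  have hφ' : ∀ x, ∃ k : ℤ, |k| ≤ N ∧ φ.symm x = iter T k x := by
    intro x
    obtain ⟨k, hk, hkx⟩ := hφ (φ.symm x)
    refine ⟨-k, by simpa using hk, ?_⟩
    rw [φ.apply_symm_apply] at hkx
    conv_rhs => rw [hkx]
    simp
  have habs : ∀ a b : ℤ, |a| ≤ N → |b| ≤ N → |a + 1 + b| ≤ (2 * N + 1 : ℕ) := by
    intro a b ha hb
    rw [abs_le] at *
    constructor <;> push_cast <;> linarith
  constructor
  · obtain ⟨a, ha, hax⟩ := hφ' x
    obtain ⟨b, hb, hbx⟩ := hφ (T (φ.symm x))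
    refine ⟨b + 1 + a, habs b a hb ha, ?_⟩
    rw [conj_apply, hbx, iter_add, iter_add, iter_one, hax]
  · obtain ⟨a, ha, hax⟩ := hφ (φ.symm x)
    obtain ⟨b, hb, hbx⟩ := hφ' (T x)
    refine ⟨b + 1 + a, habs b a hb ha, ?_⟩
    rw [φ.apply_symm_apply] at hax
    conv_rhs => rw [← φ.apply_symm_apply x]
    rw [iter_conj, iter_add, iter_add, iter_one, ← hax, ← hbx, φ.apply_symm_apply]

theorem exists_iter_tower_equiv {T φ : X ≃ᵐ X} {N : ℕ} {B : Set X} {σ : ℕ → Equiv.Perm (Fin N)}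
    {t : X → ℕ}
    (h1 : ∀ b ∈ B, ∀ p : Fin N, φ (iter T (p : ℕ) b) = iter T (σ (t b) p : ℕ) b)
    (h2 : ∀ x ∉ tower T N B, φ x = x) (x : X) : ∃ k : ℤ, |k| ≤ N ∧ φ x = iter T k x := by
  by_cases hx : x ∈ tower T N B
  · obtain ⟨i, hi, b, hb, rfl⟩ := mem_tower.1 hx
    refine ⟨(σ (t b) ⟨i, hi⟩ : ℕ) - (i : ℕ), ?_, ?_⟩
    · have := (σ (t b) ⟨i, hi⟩).2
      rw [abs_le]; constructor <;> omega
    · rw [← iter_add, sub_add_cancel]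
      exact h1 b hb ⟨i, hi⟩
  · exact ⟨0, by simp, by rw [h2 x hx, iter_zero]⟩

/-- Breaks in the new order of a tower occur only at the ends of the runs, in the unordered
remainder, and where the tower is entered. -/
theorem measureReal_conj_ne_le {μ : Measure X} [IsProbabilityMeasure μ] {T φ : X ≃ᵐ X}
    (hT : MeasurePreserving T μ μ) (hφ : MeasurePreserving φ μ μ)
    {N K h : ℕ} {B : Set X} {σ : ℕ → Equiv.Perm (Fin N)} {t : X → ℕ}
    (hKh : K * h ≤ N)
    (h1 : ∀ b ∈ B, ∀ p : Fin N, φ (iter T (p : ℕ) b) = iter T (σ (t b) p : ℕ) b)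
    (h2 : ∀ x ∉ tower T N B, φ x = x)
    (hσ : ∀ b, ∀ p : Fin N, (p : ℕ) < K * h → (σ (t b) p : ℕ) = p + t b * (p / h)) :
    μ.real {x | conj φ T x ≠ T x} ≤ (K + (N - K * h : ℕ) + 2) * μ.real B := by
  classical
  set bad : Finset ℕ := ((Finset.range (K * h)).filter fun p => h ∣ p + 1) ∪
    Finset.Ico (K * h - 1) N with hbad
  have hcard : bad.card ≤ K + (N - K * h) + 1 := by
    refine (Finset.card_union_le _ _).trans ?_
    rw [Nat.card_multiples, Nat.card_Ico]
    have : K * h / h ≤ K := Nat.div_le_of_le_mul (by rw [mul_comm])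
    omega
  have hsub : φ ⁻¹' {x | conj φ T x ≠ T x} ⊆
      (⋃ p ∈ bad, iter T (p : ℕ) '' B) ∪ iter T (-1) '' B := by
    intro y hy
    by_contra hcon
    rw [Set.mem_union, not_or] at hcon
    obtain ⟨hc1, hc2⟩ := hcon
    refine hy ?_
    rw [conj_apply, φ.symm_apply_apply]
    by_cases hyt : y ∈ tower T N B
    · obtain ⟨p, hp, b, hb, rfl⟩ := mem_tower.1 hyt
      have hpb : p ∉ bad := fun hmem => hc1 (Set.mem_biUnion (Finset.mem_coe.2 hmem) ⟨b, hb, rfl⟩)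
      simp only [hbad, Finset.mem_union, Finset.mem_filter, Finset.mem_range, Finset.mem_Ico,
        not_or, not_and] at hpb
      have hp1 : p + 1 < K * h := by
        by_contra hge
        exact hpb.2 (by omega) hp
      have hdvd : ¬ h ∣ p + 1 := hpb.1 (by omega)
      have e1 := h1 b hb ⟨p, hp⟩
      have e2 := h1 b hb ⟨p + 1, by omega⟩
      have s1 := hσ b ⟨p, hp⟩ (by dsimp only; omega)
      have s2 := hσ b ⟨p + 1, by omega⟩ hp1
      have hTp : T (iter T (p : ℕ) b) = iter T ((p + 1 : ℕ) : ℤ) b := by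
        rw [Nat.cast_succ, iter_add_one]
      dsimp only at e1 e2 s1 s2
      rw [hTp, e1, e2, s1, s2, Nat.succ_div_of_not_dvd hdvd, ← iter_one, ← iter_add]
      congr 1
      push_cast; ring
    · have hTy : T y ∉ tower T N B := by
        intro hmem
        obtain ⟨p, hp, b, hb, he⟩ := mem_tower.1 hmem
        obtain _ | p := p
        · refine hc2 ⟨b, hb, ?_⟩
          rw [iter_neg_one, T.symm_apply_eq]; exact he
        · refine hyt (mem_tower.2 ⟨p, by omega, b, hb, ?_⟩)
          apply T.injective
          rw [← he, Nat.cast_succ, iter_add_one]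
      rw [h2 y hyt, h2 _ hTy]
  have hlev : ∀ i : ℤ, μ.real (iter T i '' B) = μ.real B := fun i => by
    rw [measureReal_def, measure_image_iter hT, measureReal_def]
  calc μ.real {x | conj φ T x ≠ T x} = μ.real (φ ⁻¹' {x | conj φ T x ≠ T x}) := by
        rw [measureReal_def, measureReal_def, hφ.measure_preimage_equiv]
    _ ≤ μ.real (⋃ p ∈ bad, iter T (p : ℕ) '' B) + μ.real (iter T (-1) '' B) :=
        (measureReal_mono hsub).trans (measureReal_union_le _ _)
    _ ≤ ∑ p ∈ bad, μ.real (iter T (p : ℕ) '' B) + μ.real (iter T (-1) '' B) := by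
        gcongr
        exact measureReal_biUnion_finset_le _ _
    _ = (bad.card + 1) * μ.real B := by
        simp only [hlev, Finset.sum_const, nsmul_eq_mul]; ring
    _ ≤ (K + (N - K * h : ℕ) + 2) * μ.real B := by
        have : (bad.card : ℝ) ≤ K + (N - K * h : ℕ) + 1 := by exact_mod_cast hcard
        exact mul_le_mul_of_nonneg_right (by linarith) measureReal_nonneg

end Tower

/-! ### Mixing by equidistributed shifts -/

section Shift

variable {X : Type*} [MeasurableSpace X] {μ : Measure X} [IsProbabilityMeasure μ]

/-- A uniformly distributed function independent of finitely many given sets. -/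
theorem exists_equidistributed_sets [StandardBorelSpace X] [NullSingletonClass μ] {ι : Type*}
    [Finite ι] (M : ℕ) {C : ι → Set X} (hC : ∀ i, MeasurableSet (C i)) :
    ∃ t : X → ℕ, Measurable t ∧ (∀ x, t x < M + 1) ∧
      ∀ i, ∀ s < M + 1, μ.real (C i ∩ t ⁻¹' {s}) = μ.real (C i) / (M + 1) := by
  classical
  have := Fintype.ofFinite ι
  set n : X → ι → Prop := fun x i => x ∈ C i with hn
  have hnm : ∀ v, MeasurableSet (n ⁻¹' {v}) := by
    intro v
    have : n ⁻¹' {v} = ⋂ i, {x | x ∈ C i ↔ v i} := by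
      ext x
      simp [hn, funext_iff]
    rw [this]
    refine .iInter fun i => ?_
    by_cases hv : v i
    · simpa [hv] using hC i
    · have : {x | x ∈ C i ↔ v i} = (C i)ᶜ := by ext x; simp [hv]
      rw [this]; exact (hC i).compl
  obtain ⟨t, ht, htM, hts⟩ := exists_equidistributed (μ := μ) M hnm
  refine ⟨t, ht, htM, fun i s hs => ?_⟩
  have hunion : C i = ⋃ v ∈ Finset.univ.filter fun v : ι → Prop => v i, n ⁻¹' {v} := by
    ext x
    simp [hn]
  have hdis : ∀ v w : ι → Prop, v ≠ w → Disjoint (n ⁻¹' {v}) (n ⁻¹' {w}) := fun v w hvw =>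
    Disjoint.preimage n (by simpa using hvw)
  have h1 : μ.real (C i) = ∑ v ∈ Finset.univ.filter fun v : ι → Prop => v i,
      μ.real (n ⁻¹' {v}) := by
    conv_lhs => rw [hunion]
    exact measureReal_biUnion_finset (fun v _ w _ hvw => hdis v w hvw) fun v _ => hnm v
  have h2 : μ.real (C i ∩ t ⁻¹' {s}) = ∑ v ∈ Finset.univ.filter fun v : ι → Prop => v i,
      μ.real (n ⁻¹' {v} ∩ t ⁻¹' {s}) := by
    conv_lhs => rw [hunion, Set.iUnion₂_inter]
    exact measureReal_biUnion_finset (fun v _ w _ hvw =>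
      (hdis v w hvw).mono Set.inter_subset_left Set.inter_subset_left)
      fun v _ => (hnm v).inter (ht (measurableSet_singleton s))
  rw [h1, h2, Finset.sum_div]
  exact Finset.sum_congr rfl fun v _ => hts v s hs

/-- The average over `s < M` of `μ (S ∩ T ^ (-(h + s)) F)`. -/
theorem sum_measureReal_inter_eq_integral {T : X ≃ᵐ X} (hT : MeasurePreserving T μ μ) {S F : Set X}
    (hF : MeasurableSet F) (h M : ℕ) :
    (M : ℝ)⁻¹ * ∑ s ∈ Finset.range M, μ.real (S ∩ iter T ((s : ℤ) + h) ⁻¹' F)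
      = ∫ x in S, visitFreq T F M (iter T h x) ∂μ := by
  unfold visitFreq
  rw [integral_const_mul, integral_finsetSum]
  · congr 1
    refine Finset.sum_congr rfl fun s _ => ?_
    have : ∀ x, F.indicator (fun _ => (1 : ℝ)) (iter T s (iter T h x))
        = (iter T ((s : ℤ) + h) ⁻¹' F).indicator (fun _ => (1 : ℝ)) x := by
      intro x
      rw [← iter_add]; rfl
    simp only [this]
    rw [integral_indicator_const _ (measurable_iter T _ hF), measureReal_restrict_apply
      (measurable_iter T _ hF), Set.inter_comm]
    simp
  · intro s _
    refine Integrable.integrableOn ?_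
    refine ((measurePreserving_iter hT h).integrable_comp_of_integrable
      (g := fun x => F.indicator (fun _ => (1 : ℝ)) (iter T s x)) ?_)
    exact (measurePreserving_iter hT s).integrable_comp_of_integrable
      ((integrable_const _).indicator hF)

/-- Averaging over a window makes the correlations of `F` with any set `S` small. -/
theorem abs_sum_measureReal_inter_sub_le {T : X ≃ᵐ X} (hT : MeasurePreserving T μ μ) {S F : Set X}
    (hF : MeasurableSet F) (h M : ℕ) :
    |(M : ℝ)⁻¹ * ∑ s ∈ Finset.range M, μ.real (S ∩ iter T ((s : ℤ) + h) ⁻¹' F)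
      - μ.real S * μ.real F| ≤ ∫ x, |visitFreq T F M x - μ.real F| ∂μ := by
  have hint : Integrable (visitFreq T F M) μ :=
      Integrable.of_bound (measurable_visitFreq T hF M).aestronglyMeasurable 1
        (.of_forall fun x => by
          rw [Real.norm_eq_abs, abs_of_nonneg (visitFreq_nonneg T F M x)]
          exact visitFreq_le_one T F M x)
  have hint' : Integrable (fun x => visitFreq T F M (iter T h x)) μ :=
    (measurePreserving_iter hT h).integrable_comp_of_integrable hint
  have e : ∫ x in S, (visitFreq T F M (iter T h x) - μ.real F) ∂μ
      = ∫ x in S, visitFreq T F M (iter T h x) ∂μ - μ.real S * μ.real F := by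
    rw [integral_sub hint'.integrableOn (integrable_const _)]
    simp
  rw [sum_measureReal_inter_eq_integral hT hF, ← e]
  refine abs_integral_le_integral_abs.trans ?_
  have hint2 : Integrable (fun x => |visitFreq T F M (iter T h x) - μ.real F|) μ :=
    (hint'.sub (integrable_const _)).abs
  refine (setIntegral_le_integral hint2 (.of_forall fun _ => abs_nonneg _)).trans_eq ?_
  exact (measurePreserving_iter hT h).integral_comp (measurableEmbedding_iter T h)
    (fun x => |visitFreq T F M x - μ.real F|)

/-- If the order of a tower is changed to place runs of length `h`, separated by gaps of length
`t b`, one after another then the `h`-th power of the new transformation acts on most points of the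
tower as `T ^ (h + t b)`. When `t` is uniformly distributed on `{0, …, M}` and independent of the
relevant events, the resulting correlations are averages of the correlations for `T`, which are
controlled by the mean ergodic theorem. -/
theorem abs_measureReal_conj_sub_le {T φ : X ≃ᵐ X} (hT : MeasurePreserving T μ μ)
    (hφ : MeasurePreserving φ μ μ) {N K h M : ℕ} {B E F : Set X} (hB : MeasurableSet B)
    (hE : MeasurableSet E) (hF : MeasurableSet F) (hbase : IsTowerBase T N B)
    {σ : ℕ → Equiv.Perm (Fin N)} {t : X → ℕ} (ht : Measurable t) (htM : ∀ x, t x < M + 1)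
    (hKh : (K + 1) * h ≤ N) (hh : 0 < h)
    (hφB : ∀ b ∈ B, ∀ p : Fin N, φ (iter T (p : ℕ) b) = iter T (σ (t b) p : ℕ) b)
    (hσ : ∀ b, ∀ p : Fin N, (p : ℕ) < (K + 1) * h → (σ (t b) p : ℕ) = p + t b * (p / h))
    (hind : ∀ p < N, ∀ s < M + 1,
      μ.real ((B ∩ iter T (p : ℕ) ⁻¹' (E ∩ iter T ((s : ℤ) + h) ⁻¹' F)) ∩ t ⁻¹' {s})
        = μ.real (B ∩ iter T (p : ℕ) ⁻¹' (E ∩ iter T ((s : ℤ) + h) ⁻¹' F)) / (M + 1)) :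
    |μ.real (E ∩ iter (conj φ T) h ⁻¹' F) - μ.real E * μ.real F|
      ≤ 2 * μ.real (tower T N B)ᶜ + (N - K * h : ℕ) * μ.real B
        + ∫ x, |visitFreq T F (M + 1) x - μ.real F| ∂μ := by
  have hlev : ∀ (i : ℤ) (C : Set X), μ.real (iter T i '' C) = μ.real C := fun i C => by
    rw [measureReal_def, measure_image_iter hT, measureReal_def]
  have hltN : ∀ {p : ℕ}, p < K * h → p + h < N := fun {p} hp => by
    have : (K + 1) * h = K * h + h := by ring
    omega
  -- The points in the first `K` runs, in the new order.
  set W : Set X := tower T (K * h) B with hW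
  -- The points `T ^ p b` of the tower lying in `E` and moved to `F` by `T ^ (h + t b)`.
  set C : ℕ → ℕ → Set X := fun p s =>
    B ∩ iter T (p : ℕ) ⁻¹' (E ∩ iter T ((s : ℤ) + h) ⁻¹' F) with hC
  have hCm : ∀ p s, MeasurableSet (C p s) := fun p s =>
    hB.inter (measurable_iter T _ (hE.inter (measurable_iter T _ hF)))
  set H : Set X := ⋃ q ∈ Finset.range N ×ˢ Finset.range (M + 1),
    iter T (q.1 : ℕ) '' (C q.1 q.2 ∩ t ⁻¹' {q.2}) with hH
  have hHmem : ∀ b ∈ B, ∀ p < N, iter T (p : ℕ) b ∈ H ↔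
      iter T (p : ℕ) b ∈ E ∧ iter T ((t b : ℤ) + h) (iter T (p : ℕ) b) ∈ F := by
    intro b hb p hp
    simp only [hH, Set.mem_iUnion, Finset.mem_product, Finset.mem_range, exists_prop, Prod.exists]
    constructor
    · rintro ⟨p', s, ⟨hp', hs⟩, b', ⟨⟨hb', hE', hF'⟩, hts⟩, he⟩
      obtain ⟨rfl, rfl⟩ := hbase.eq_and_eq hb' hb hp' hp he
      have hts : t b' = s := hts
      rw [hts]
      exact ⟨hE', hF'⟩
    · rintro ⟨hE', hF'⟩
      exact ⟨p, t b, ⟨hp, htM b⟩, b, ⟨⟨hb, hE', hF'⟩, rfl⟩, rfl⟩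
  have hWc : μ.real Wᶜ ≤ μ.real (tower T N B)ᶜ + (N - K * h : ℕ) * μ.real B := by
    have hsub : Wᶜ ⊆ (tower T N B)ᶜ ∪ ⋃ p ∈ Finset.Ico (K * h) N, iter T (p : ℕ) '' B := by
      intro x hx
      by_cases hxt : x ∈ tower T N B
      · obtain ⟨p, hp, b, hb, rfl⟩ := mem_tower.1 hxt
        have hpK : K * h ≤ p := by
          by_contra hlt
          exact hx (mem_tower.2 ⟨p, not_le.1 hlt, b, hb, rfl⟩)
        exact .inr (Set.mem_biUnion (Finset.mem_coe.2 (Finset.mem_Ico.2 ⟨hpK, hp⟩)) ⟨b, hb, rfl⟩)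
      · exact .inl hxt
    refine (measureReal_mono hsub).trans ((measureReal_union_le _ _).trans ?_)
    gcongr
    refine (measureReal_biUnion_finset_le _ _).trans_eq ?_
    simp only [hlev, Finset.sum_const, Nat.card_Ico, nsmul_eq_mul]
  have hG : |μ.real (φ ⁻¹' (E ∩ iter (conj φ T) h ⁻¹' F)) - μ.real (φ ⁻¹' H)| ≤ μ.real Wᶜ := by
    have key : ∀ y ∈ W, φ y ∈ E ∩ iter (conj φ T) h ⁻¹' F ↔ φ y ∈ H := by
      intro y hy
      obtain ⟨p, hp, b, hb, rfl⟩ := mem_tower.1 hy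
      have hpN := hltN hp
      have hKh' : p + h < (K + 1) * h := by
        have : (K + 1) * h = K * h + h := by ring
        omega
      have e1 := hφB b hb ⟨p, by omega⟩
      have e2 := hφB b hb ⟨p + h, hpN⟩
      have s1 := hσ b ⟨p, by omega⟩ (by dsimp only; omega)
      have s2 := hσ b ⟨p + h, hpN⟩ hKh'
      have s3 := (σ (t b) ⟨p, by omega⟩).2
      dsimp only at e1 e2 s1 s2
      rw [Nat.add_div_right _ hh] at s2
      rw [s1] at s3
      have e3 : iter (conj φ T) h (φ (iter T (p : ℕ) b))
          = iter T ((t b : ℤ) + h) (φ (iter T (p : ℕ) b)) := by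
        rw [iter_conj, ← iter_add, add_comm, ← Nat.cast_add, e2, e1, s1, s2, ← iter_add]
        congr 1
        push_cast; ring
      rw [Set.mem_inter_iff, Set.mem_preimage, e3, e1, s1, hHmem b hb _ s3]
    refine abs_measureReal_sub_le _ _ _ (fun y hy => ?_) (fun y hy => ?_)
    · by_cases hyW : y ∈ W
      · exact .inl ((key y hyW).1 hy)
      · exact .inr hyW
    · by_cases hyW : y ∈ W
      · exact .inl ((key y hyW).2 hy)
      · exact .inr hyW
  have hφr : ∀ D : Set X, μ.real (φ ⁻¹' D) = μ.real D := fun D => by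
    rw [measureReal_def, hφ.measure_preimage_equiv, measureReal_def]
  rw [hφr, hφr] at hG
  have hHm : μ.real H = ((M + 1 : ℕ) : ℝ)⁻¹ * ∑ s ∈ Finset.range (M + 1),
      μ.real ((tower T N B ∩ E) ∩ iter T ((s : ℤ) + h) ⁻¹' F) := by
    have h1 : μ.real H = ∑ q ∈ Finset.range N ×ˢ Finset.range (M + 1),
        μ.real (C q.1 q.2) / (M + 1) := by
      rw [hH, measureReal_biUnion_finset]
      · refine Finset.sum_congr rfl fun q hq => ?_
        rw [Finset.mem_product, Finset.mem_range, Finset.mem_range] at hq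
        rw [hlev, hind q.1 hq.1 q.2 hq.2]
      · rintro ⟨p, s⟩ hq ⟨p', s'⟩ hq' hne
        rw [Finset.mem_coe, Finset.mem_product, Finset.mem_range, Finset.mem_range] at hq hq'
        refine Set.disjoint_left.2 ?_
        rintro _ ⟨b, ⟨⟨hb, -⟩, hs⟩, rfl⟩ ⟨b', ⟨⟨hb', -⟩, hs'⟩, he⟩
        obtain ⟨e1, rfl⟩ := hbase.eq_and_eq hb' hb hq'.1 hq.1 he
        exact hne (Prod.ext e1.symm (Eq.trans (Eq.symm hs) hs'))
      · exact fun q _ => measurableSet_level ((hCm _ _).inter (ht (measurableSet_singleton _))) _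
    have h2 : ∀ s, ∑ p ∈ Finset.range N, μ.real (C p s)
        = μ.real ((tower T N B ∩ E) ∩ iter T ((s : ℤ) + h) ⁻¹' F) := by
      intro s
      have : (tower T N B ∩ E) ∩ iter T ((s : ℤ) + h) ⁻¹' F
          = ⋃ p ∈ Finset.range N, iter T (p : ℕ) '' C p s := by
        ext x
        simp only [Set.mem_inter_iff, mem_tower, Set.mem_iUnion, Finset.mem_range, exists_prop]
        constructor
        · rintro ⟨⟨⟨p, hp, b, hb, rfl⟩, hxE⟩, hxF⟩
          exact ⟨p, hp, b, ⟨hb, hxE, hxF⟩, rfl⟩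
        · rintro ⟨p, hp, b, ⟨hb, hxE, hxF⟩, rfl⟩
          exact ⟨⟨⟨p, hp, b, hb, rfl⟩, hxE⟩, hxF⟩
      rw [this, measureReal_biUnion_finset]
      · simp only [hlev]
      · intro p hp p' hp' hne
        refine Set.disjoint_left.2 ?_
        rintro _ ⟨b, ⟨hb, -⟩, rfl⟩ ⟨b', ⟨hb', -⟩, he⟩
        exact hne (hbase.eq_and_eq hb' hb (by simpa using hp') (by simpa using hp) he).1.symm
      · exact fun p _ => measurableSet_level (hCm _ _) _
    rw [h1, Finset.sum_product_right, Finset.mul_sum]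
    refine Finset.sum_congr rfl fun s _ => ?_
    rw [← Finset.sum_div, h2]
    push_cast; ring
  have hmean := abs_sum_measureReal_inter_sub_le hT hF h (M + 1)
    (S := tower T N B ∩ E)
  rw [← hHm] at hmean
  have hEt : |μ.real (tower T N B ∩ E) - μ.real E| ≤ μ.real (tower T N B)ᶜ := by
    refine abs_measureReal_sub_le _ _ _ (fun x hx => .inl hx.2) fun x hx => ?_
    by_cases hxt : x ∈ tower T N B
    · exact .inl ⟨hxt, hx⟩
    · exact .inr hxt
  have hEF : |μ.real (tower T N B ∩ E) * μ.real F - μ.real E * μ.real F|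
      ≤ μ.real (tower T N B)ᶜ := by
    rw [← sub_mul, abs_mul, abs_of_nonneg (measureReal_nonneg (s := F))]
    exact (mul_le_of_le_one_right (abs_nonneg _) measureReal_le_one).trans hEt
  have e : μ.real (E ∩ iter (conj φ T) h ⁻¹' F) - μ.real E * μ.real F
      = (μ.real (E ∩ iter (conj φ T) h ⁻¹' F) - μ.real H)
        + (μ.real H - μ.real (tower T N B ∩ E) * μ.real F)
        + (μ.real (tower T N B ∩ E) * μ.real F - μ.real E * μ.real F) := by ring
  rw [e]
  refine (abs_add_three _ _ _).trans ?_
  linarith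

end Shift

/-! ### One change of the orbit order -/

/-- Logarithms of linear functions are negligible compared to the argument. -/
theorem tendsto_log_linear_div (a b c : ℝ) (ha : 0 < a) (hb : 0 < b) :
    Tendsto (fun h : ℕ => c / h * Real.log (a + b * h)) atTop (𝓝 0) := by
  have h1 : Tendsto (fun h : ℕ => a + b * (h : ℝ)) atTop atTop :=
    tendsto_atTop_add_const_left _ _ (tendsto_natCast_atTop_atTop.const_mul_atTop hb)
  have h2 : Tendsto (fun h : ℕ => Real.log (a + b * h) / (a + b * h)) atTop (𝓝 0) :=
    (Real.isLittleO_log_id_atTop.tendsto_div_nhds_zero).comp h1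
  have h3 : Tendsto (fun h : ℕ => c * (a * (h : ℝ)⁻¹ + b)) atTop (𝓝 (c * (a * 0 + b))) :=
    ((tendsto_inv_atTop_nhds_zero_nat.const_mul a).add_const b).const_mul c
  have h4 := h3.mul h2
  rw [mul_zero] at h4
  refine h4.congr' ?_
  filter_upwards [eventually_gt_atTop 0] with h hh
  have : (0 : ℝ) < h := by exact_mod_cast hh
  have : 0 < a + b * h := by positivity
  field_simp

section Step

variable {X : Type*} [MeasurableSpace X] [StandardBorelSpace X] {μ : Measure X}
  [IsProbabilityMeasure μ] [NullSingletonClass μ]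

/-- An ergodic transformation can be changed on a set that is small, even after multiplication with
the logarithm of the lengths of the jumps introduced, to a conjugate transformation with the same
orbits that is almost mixing on given sets at some time. -/
theorem exists_orbit_change {T : X ≃ᵐ X} (hT : Ergodic T μ) {ι : Type*} [Finite ι] {A : ι → Set X}
    (hA : ∀ i, MeasurableSet (A i)) (R : ℕ) {δ : ℝ} (hδ : 0 < δ) :
    ∃ (U : X ≃ᵐ X) (D l : ℕ), Ergodic U μ ∧ l ≤ D ∧ 2 ≤ D ∧
      (∀ x, ∃ k : ℤ, |k| ≤ D ∧ U x = iter T k x) ∧ (∀ x, ∃ k : ℤ, |k| ≤ D ∧ T x = iter U k x) ∧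
      μ.real {x | U x ≠ T x} * ((2 * R + 1) * Real.log (1 + R * D)) ≤ δ ∧
      ∀ i j, |μ.real (A i ∩ iter U l ⁻¹' A j) - μ.real (A i) * μ.real (A j)| ≤ δ := by
  have hmp := hT.toMeasurePreserving
  have hδ5 : 0 < δ / 5 := by positivity
  -- The window length `M + 1` is given by the mean ergodic theorem.
  obtain ⟨M, hM⟩ : ∃ M : ℕ, ∀ i, ∫ x, |visitFreq T (A i) (M + 1) x - μ.real (A i)| ∂μ ≤ δ / 5 := by
    have h1 : ∀ᶠ n : ℕ in atTop, ∀ i,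
        ∫ x, |visitFreq T (A i) n x - μ.real (A i)| ∂μ ≤ δ / 5 :=
      eventually_all.2 fun i => (tendsto_integral_abs_visitFreq_sub hT (hA i)).eventually
        (ge_mem_nhds hδ5)
    obtain ⟨n, hn, hn0⟩ := (h1.and (eventually_gt_atTop 0)).exists
    obtain ⟨M, rfl⟩ := Nat.exists_eq_succ_of_ne_zero hn0.ne'
    exact ⟨M, hn⟩
  -- The number `K + 1` of runs makes the last one negligible.
  obtain ⟨K, hK⟩ := exists_nat_one_div_lt hδ5
  -- The length `h` of the runs dominates everything else.
  obtain ⟨h, hh, hgap, hcost⟩ : ∃ h : ℕ, 0 < h ∧ (M : ℝ) / h ≤ δ / 5 ∧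
      (M + 3) * (2 * R + 1) / h * Real.log ((1 + R * (2 * (K + 1) * M + 1))
        + (R * (2 * (K + 1)) + 1) * h) ≤ δ := by
    have h1 := (tendsto_const_div_atTop_nhds_zero_nat (M : ℝ)).eventually (ge_mem_nhds hδ5)
    have h2 := (tendsto_log_linear_div (1 + R * (2 * (K + 1) * M + 1)) (R * (2 * (K + 1)) + 1)
      ((M + 3) * (2 * R + 1)) (by positivity) (by positivity)).eventually (ge_mem_nhds hδ)
    obtain ⟨h, h3, h4, h5⟩ := ((eventually_gt_atTop 0).and (h1.and h2)).exists
    exact ⟨h, h3, h4, h5⟩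
  have hh' : (0 : ℝ) < h := by exact_mod_cast hh
  set N : ℕ := (K + 1) * (h + M) with hN
  have hNpos : 0 < N := by positivity
  have hKh : (K + 1) * h ≤ N := Nat.mul_le_mul_left _ (Nat.le_add_right _ _)
  obtain ⟨B, hB, hbase, hBm⟩ := exists_rokhlin_tower hT hNpos hδ5
  change IsTowerBase T N B at hbase
  change μ.real (tower T N B)ᶜ ≤ δ / 5 at hBm
  obtain ⟨t, ht, htM, hts⟩ := exists_equidistributed_sets (μ := μ) M
    (C := fun q : ι × ι × Fin N × Fin (M + 1) => B ∩ iter T ((q.2.2.1 : ℕ) : ℤ) ⁻¹'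
      (A q.1 ∩ iter T (((q.2.2.2 : ℕ) : ℤ) + h) ⁻¹' A q.2.1))
    fun q => hB.inter (measurable_iter T _ ((hA _).inter (measurable_iter T _ (hA _))))
  have hσ : ∀ s : ℕ, ∃ σ : Equiv.Perm (Fin N), s < M + 1 →
      ∀ p : Fin N, (p : ℕ) < (K + 1) * h → (σ p : ℕ) = p + s * (p / h) := by
    intro s
    by_cases hs : s < M + 1
    · obtain ⟨σ, hσ⟩ := exists_perm_skip (K := K + 1) (h := h) (t := s) (N := N)
        (Nat.mul_le_mul_left _ (by omega))
      exact ⟨σ, fun _ => hσ⟩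
    · exact ⟨1, fun h => absurd h hs⟩
  choose σ hσ using hσ
  obtain ⟨φ, hφ1, hφ2⟩ := exists_tower_equiv hbase hB σ ht
  have hφo : ∀ x, ∃ k : ℤ, |k| ≤ N ∧ φ x = iter T k x := exists_iter_tower_equiv hφ1 hφ2
  have hφmp : MeasurePreserving φ μ μ := measurePreserving_of_mem_orbit hmp fun x => by
    obtain ⟨k, -, hk⟩ := hφo x
    exact ⟨k, hk⟩
  have hσt : ∀ b, ∀ p : Fin N, (p : ℕ) < (K + 1) * h → (σ (t b) p : ℕ) = p + t b * (p / h) :=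
    fun b => hσ (t b) (htM b)
  have hNB := hbase.mul_measureReal_le hmp hB
  have hNcast : (N : ℝ) = (K + 1) * (h + M) := by rw [hN]; push_cast; ring
  have hBN : μ.real B ≤ 1 / ((K + 1) * (h + M)) := by
    rw [le_div_iff₀ (by positivity), ← hNcast, mul_comm]; exact hNB
  refine ⟨conj φ T, 2 * N + 1, h, ?_, ?_, ?_, fun x => (exists_iter_conj hφo x).1,
    fun x => (exists_iter_conj hφo x).2, ?_, fun i j => ?_⟩
  · have := (hφmp.ergodic_conjugate_iff (f := T)).2 hT
    exact this
  · have : h ≤ (K + 1) * h := Nat.le_mul_of_pos_left _ (by omega)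
    omega
  · omega
  · have h1 := measureReal_conj_ne_le hmp hφmp hKh hφ1 hφ2 hσt
    have h2 : N - (K + 1) * h = (K + 1) * M := by rw [hN, mul_add]; omega
    rw [h2] at h1
    have h3 : μ.real {x | conj φ T x ≠ T x} ≤ (M + 3) / h := by
      refine h1.trans ?_
      push_cast
      calc ((K : ℝ) + 1 + (K + 1) * M + 2) * μ.real B
          ≤ ((K + 1) * (M + 3)) * (1 / ((K + 1) * (h + M))) := by
            gcongr
            nlinarith [(Nat.cast_nonneg K : (0 : ℝ) ≤ K)]
        _ = (M + 3) / (h + M) := by field_simp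
        _ ≤ (M + 3) / h := by
            gcongr
            linarith [(Nat.cast_nonneg M : (0 : ℝ) ≤ M)]
    have h4 : (1 + R * ((2 * N + 1 : ℕ) : ℝ)) ≤ (1 + R * (2 * (K + 1) * M + 1))
        + (R * (2 * (K + 1)) + 1) * h := by
      push_cast
      rw [hNcast]
      nlinarith
    have h5 : 0 ≤ Real.log (1 + R * ((2 * N + 1 : ℕ) : ℝ)) := Real.log_nonneg (by
      have : (0 : ℝ) ≤ R * ((2 * N + 1 : ℕ) : ℝ) := by positivity
      linarith)
    calc μ.real {x | conj φ T x ≠ T x} * ((2 * R + 1) * Real.log (1 + R * ((2 * N + 1 : ℕ) : ℝ)))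
        ≤ (M + 3) / h * ((2 * R + 1) * Real.log ((1 + R * (2 * (K + 1) * M + 1))
          + (R * (2 * (K + 1)) + 1) * h)) := by
          gcongr
      _ = (M + 3) * (2 * R + 1) / h * Real.log ((1 + R * (2 * (K + 1) * M + 1))
          + (R * (2 * (K + 1)) + 1) * h) := by ring
      _ ≤ δ := hcost
  · have h1 := abs_measureReal_conj_sub_le hmp hφmp (N := N) (K := K) (h := h) (M := M) hB (hA i)
      (hA j) hbase ht htM hKh hh hφ1 hσt
      (fun p hp s hs => hts (i, j, ⟨p, hp⟩, ⟨s, hs⟩) s hs)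
    have h2 : ((N - K * h : ℕ) : ℝ) * μ.real B ≤ δ / 5 + δ / 5 := by
      have e : N - K * h = (K + 1) * M + h := by
        have : N = K * h + h + (K + 1) * M := by rw [hN]; ring
        omega
      rw [e]
      push_cast
      calc (((K : ℝ) + 1) * M + h) * μ.real B
          ≤ ((K + 1) * M + h) * (1 / ((K + 1) * (h + M))) := by gcongr
        _ = M / (h + M) + (1 / (K + 1)) * (h / (h + M)) := by field_simp
        _ ≤ M / h + 1 / (K + 1) := by
            have hM0 : (0 : ℝ) ≤ M := Nat.cast_nonneg M
            refine add_le_add ?_ ?_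
            · gcongr; linarith
            · refine mul_le_of_le_one_right (by positivity) ?_
              rw [div_le_one (by positivity)]; linarith
        _ ≤ δ / 5 + δ / 5 := add_le_add hgap hK.le
    linarith [hM j]

end Step

/-! ### Logarithmic moments and Shannon entropy -/

section Entropy

variable {X : Type*} [MeasurableSpace X] {μ : Measure X} [IsProbabilityMeasure μ]

/-- The cases `p ≥ c⁻⁴` and `p < c⁻⁴` are covered by the two terms on the right. -/
theorem negMulLog_le_of_one_le {p c : ℝ} (hp : 0 ≤ p) (hc : 1 ≤ c) :
    Real.negMulLog p ≤ 4 * (p * Real.log c) + 2 * (1 / c ^ 2) := by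
  have hc0 : 0 < c := by linarith
  have hlog : 0 ≤ Real.log c := Real.log_nonneg hc
  rcases hp.eq_or_lt with rfl | hp
  · simp only [Real.negMulLog_zero, zero_mul, mul_zero, zero_add]; positivity
  rcases le_or_gt (1 / c ^ 4) p with h | h
  · have h1 : -Real.log p ≤ 4 * Real.log c := by
      have := Real.log_le_log (by positivity) h
      rw [one_div, Real.log_inv, Real.log_pow] at this
      push_cast at this
      linarith
    have h2 : Real.negMulLog p ≤ p * (4 * Real.log c) := by
      rw [Real.negMulLog, neg_mul, ← mul_neg]
      exact mul_le_mul_of_nonneg_left h1 hp.le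
    have : 0 ≤ 2 * (1 / c ^ 2) := by positivity
    linarith
  · have hs : 0 < √p := Real.sqrt_pos.2 hp
    have hsq : √p * √p = p := Real.mul_self_sqrt hp.le
    have h1 : √p ≤ 1 / c ^ 2 := by
      refine Real.sqrt_le_iff.2 ⟨by positivity, h.le.trans_eq ?_⟩
      field_simp
    have h2 : -Real.log p ≤ 2 / √p := by
      have h3 : Real.log p = 2 * Real.log √p := by
        rw [Real.log_sqrt hp.le]; ring
      have h4 := Real.one_sub_inv_le_log_of_pos hs
      rw [h3, div_eq_mul_inv]
      linarith
    have h3 : Real.negMulLog p ≤ p * (2 / √p) := by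
      rw [Real.negMulLog, neg_mul, ← mul_neg]
      exact mul_le_mul_of_nonneg_left h2 hp.le
    have h4 : p * (2 / √p) = 2 * √p := by
      rw [← mul_div_assoc, div_eq_iff hs.ne']; linarith
    have : 0 ≤ p * Real.log c := by positivity
    linarith

/-- An integer-valued random variable with finite logarithmic moment has finite entropy. -/
theorem hasFiniteShannonEntropy_of_lintegral {f : X → ℤ} (hf : Measurable f)
    (h : ∫⁻ x, ENNReal.ofReal (Real.log (1 + |(f x : ℝ)|)) ∂μ ≠ ⊤) :
    HasFiniteShannonEntropy μ f := by
  have h1 : Summable fun n : ℤ => μ.real {x | f x = n} * Real.log (1 + |(n : ℝ)|) := by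
    have e : ∫⁻ x, ENNReal.ofReal (Real.log (1 + |(f x : ℝ)|)) ∂μ
        = ∑' n : ℤ, ENNReal.ofReal (Real.log (1 + |(n : ℝ)|)) * μ {x | f x = n} := by
      rw [← lintegral_map (f := fun n : ℤ => ENNReal.ofReal (Real.log (1 + |(n : ℝ)|)))
        measurable_from_top hf, lintegral_countable']
      refine tsum_congr fun n => ?_
      rw [Measure.map_apply hf (measurableSet_singleton n)]
      rfl
    rw [e] at h
    refine (ENNReal.summable_toReal h).congr fun n => ?_
    rw [ENNReal.toReal_mul, ENNReal.toReal_ofReal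
      (Real.log_nonneg (by linarith [abs_nonneg (n : ℝ)])), mul_comm, measureReal_def]
  have h2 : Summable fun n : ℤ => 1 / (1 + |(n : ℝ)|) ^ 2 := by
    have h3 : Summable fun n : ℕ => 1 / (1 + (n : ℝ)) ^ 2 := by
      have := (summable_nat_add_iff 1).2 (Real.summable_one_div_nat_pow.2 (by norm_num : 1 < 2))
      refine this.congr fun n => ?_
      push_cast; rw [add_comm]
    refine Summable.of_nat_of_neg ?_ ?_
    · simpa using h3
    · simpa using h3
  refine Summable.of_nonneg_of_le (fun n => ?_) (fun n => ?_) ((h1.mul_left 4).add (h2.mul_left 2))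
  · exact Real.negMulLog_nonneg measureReal_nonneg measureReal_le_one
  · exact negMulLog_le_of_one_le measureReal_nonneg (by linarith [abs_nonneg (n : ℝ)])

theorem ofReal_log_one_add_le (a b : ℤ) :
    ENNReal.ofReal (Real.log (1 + |((a + b : ℤ) : ℝ)|)) ≤
      ENNReal.ofReal (Real.log (1 + |(a : ℝ)|)) + ENNReal.ofReal (Real.log (1 + |(b : ℝ)|)) := by
  have ha := abs_nonneg (a : ℝ)
  have hb := abs_nonneg (b : ℝ)
  rw [← ENNReal.ofReal_add (Real.log_nonneg (by linarith)) (Real.log_nonneg (by linarith)),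
    ← Real.log_mul (by linarith) (by linarith)]
  refine ENNReal.ofReal_le_ofReal (Real.log_le_log (by positivity) ?_)
  have := abs_add_le (a : ℝ) b
  push_cast
  nlinarith

/-- If `Q x` is a bounded number of steps from `x` along its `P`-orbit, with logarithm of the bound
integrable in `x`, then all powers of `Q` can be written as powers of `P` with measurable exponents
of finite entropy. -/
theorem exists_exponent_hasFiniteShannonEntropy [MeasurableEq X] {P Q : X ≃ᵐ X}
    (hQ : MeasurePreserving Q μ μ) {G : Set X} (hG : MeasurableSet G) (hGμ : ∀ᵐ x ∂μ, x ∈ G)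
    (hGQ : ∀ x ∈ G, ∀ g, iter Q g x ∈ G) {L : X → ENNReal} (hL : Measurable L)
    (hLfin : ∫⁻ x, L x ∂μ ≠ ⊤)
    (h : ∀ x ∈ G, ∃ k : ℤ, Q x = iter P k x ∧ ENNReal.ofReal (Real.log (1 + |(k : ℝ)|)) ≤ L x)
    (g : ℤ) :
    ∃ κ : X → ℤ, Measurable κ ∧ (∀ x ∈ G, iter P (κ x) x = iter Q g x) ∧
      HasFiniteShannonEntropy μ κ := by
  have key : ∀ (n : ℕ), ∀ x ∈ G, ∃ k : ℤ, iter Q n x = iter P k x ∧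
      ENNReal.ofReal (Real.log (1 + |(k : ℝ)|)) ≤ ∑ i ∈ Finset.range n, L (iter Q i x) := by
    intro n x hx
    induction n with
    | zero => exact ⟨0, rfl, by simp⟩
    | succ n ih =>
      obtain ⟨k, hk, hkL⟩ := ih
      obtain ⟨j, hj, hjL⟩ := h _ (hGQ x hx n)
      refine ⟨j + k, ?_, ?_⟩
      · rw [Nat.cast_succ, iter_add_one, hj, hk, iter_add]
      · rw [Finset.sum_range_succ, add_comm (Finset.sum _ _)]
        exact (ofReal_log_one_add_le j k).trans (add_le_add hjL hkL)
  obtain ⟨L', hL', hL'fin, hbound⟩ : ∃ L' : X → ENNReal, Measurable L' ∧ ∫⁻ x, L' x ∂μ ≠ ⊤ ∧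
      ∀ x ∈ G, ∃ k : ℤ, iter Q g x = iter P k x ∧
        ENNReal.ofReal (Real.log (1 + |(k : ℝ)|)) ≤ L' x := by
    have hint : ∀ i : ℤ, ∫⁻ x, L (iter Q i x) ∂μ = ∫⁻ x, L x ∂μ := fun i =>
      (measurePreserving_iter hQ i).lintegral_comp hL
    obtain ⟨n, rfl | rfl⟩ := g.eq_nat_or_neg
    · refine ⟨fun x => ∑ i ∈ Finset.range n, L (iter Q i x),
        Finset.measurable_fun_sum _ fun i _ => hL.comp (measurable_iter Q i), ?_, key n⟩
      have hm : ∀ i : ℕ, Measurable fun x => L (iter Q i x) :=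
        fun i => hL.comp (measurable_iter Q i)
      rw [lintegral_finsetSum _ fun i _ => hm i]
      exact ENNReal.sum_ne_top.2 fun i _ => by rw [hint]; exact hLfin
    · refine ⟨fun x => ∑ i ∈ Finset.range n, L (iter Q i (iter Q (-n : ℤ) x)),
        Finset.measurable_fun_sum _ fun i _ =>
          hL.comp ((measurable_iter Q i).comp (measurable_iter Q _)), ?_, fun x hx => ?_⟩
      · have hm : ∀ i : ℕ, Measurable fun x => L (iter Q i (iter Q (-n : ℤ) x)) :=
          fun i => hL.comp ((measurable_iter Q i).comp (measurable_iter Q _))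
        rw [lintegral_finsetSum _ fun i _ => hm i]
        refine ENNReal.sum_ne_top.2 fun i _ => ?_
        simp only [← iter_add]
        rw [hint]; exact hLfin
      · obtain ⟨k, hk, hkL⟩ := key n _ (hGQ x hx (-n))
        refine ⟨-k, ?_, by simpa using hkL⟩
        rw [iter_apply_iter_neg] at hk
        conv_rhs => rw [hk]
        simp
  obtain ⟨κ, hκ, hκx⟩ := exists_measurable_int
    (fun k => {x | iter P k x = iter Q g x} ∪ Gᶜ)
    (fun k => (measurableSet_eq_fun (measurable_iter P k) (measurable_iter Q g)).union hG.compl)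
    (fun x => by
      by_cases hx : x ∈ G
      · obtain ⟨k, hk, -⟩ := hbound x hx
        exact ⟨k, .inl hk.symm⟩
      · exact ⟨0, .inr hx⟩)
  refine ⟨κ, hκ, fun x hx => ?_, hasFiniteShannonEntropy_of_lintegral hκ ?_⟩
  · exact (hκx x).1.resolve_right (fun h => h hx)
  · refine ne_top_of_le_ne_top hL'fin (lintegral_mono_ae ?_)
    filter_upwards [hGμ] with x hx
    obtain ⟨k, hk, hkL⟩ := hbound x hx
    refine le_trans (ENNReal.ofReal_le_ofReal (Real.log_le_log (by positivity) ?_)) hkL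
    have := (hκx x).2 k (.inl hk.symm)
    have h2 : |(κ x : ℝ)| ≤ |(k : ℝ)| := by exact_mod_cast this
    linarith

end Entropy

/-! ### Freeness of orbit equivalent transformations -/

/-- A periodic point of `T` would have a finite `T`-orbit, whereas its `S`-orbit is infinite. -/
theorem iter_ne_self_of_range_eq {X : Type*} [MeasurableSpace X] {S T : X ≃ᵐ X} {x : X}
    (hS : ∀ g : ℤ, g ≠ 0 → iter S g x ≠ x)
    (h : (Set.range fun g : ℤ => iter S g x) = Set.range fun g : ℤ => iter T g x)
    {g : ℤ} (hg : g ≠ 0) : iter T g x ≠ x := by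
  intro hgx
  have hmul : ∀ q : ℤ, iter T (g * q) x = x := by
    intro q
    have : (((T.toEquiv : Equiv.Perm X) ^ g) ^ q) x = x :=
      Equiv.Perm.zpow_apply_eq_self_of_apply_eq_self hgx q
    rwa [← zpow_mul] at this
  have hfin : (Set.range fun m : ℤ => iter T m x).Finite := by
    refine ((Set.finite_Ico (0 : ℤ) |g|).image fun m => iter T m x).subset ?_
    rintro _ ⟨m, rfl⟩
    refine ⟨m % g, ⟨Int.emod_nonneg _ hg, Int.emod_lt_abs _ hg⟩, ?_⟩
    beta_reduce
    conv_rhs => rw [← Int.emod_add_mul_ediv m g]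
    rw [iter_add, hmul]
  rw [← h] at hfin
  refine Set.infinite_range_of_injective ?_ hfin
  intro a b hab
  by_contra hne
  refine hS (a - b) (sub_ne_zero.2 hne) ?_
  apply iter_injective S b
  rw [← iter_add, add_sub_cancel]
  exact hab

/-! ### Sequences of orbit changes and their limits -/

section LimitTransformation

variable {X : Type*} [MeasurableSpace X]

/-- A sequence of measure-preserving transformations `T n` with the same orbits as `S`, at
distances at most `R n`, such that `T (n + 1)` differs from `T n` on a set that remains small after
multiplication with the number of the powers of `T n` needed to express `S` and with the
logarithm of the distances that arise. -/
structure IsOrbitChangeSeq (μ : Measure X) (S : X ≃ᵐ X) (T : ℕ → X ≃ᵐ X) (R : ℕ → ℕ) :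
    Prop where
  measurePreserving : ∀ n, MeasurePreserving (T n) μ μ
  monotone : Monotone R
  one_le : 1 ≤ R 0
  two_le : ∀ n, 2 ≤ R (n + 1)
  exists_iter : ∀ n x, ∃ k : ℤ, |k| ≤ R n ∧ T n x = iter S k x
  exists_iter' : ∀ n x, ∃ k : ℤ, |k| ≤ R n ∧ S x = iter (T n) k x
  cost : ∀ n, μ.real {x | T (n + 1) x ≠ T n x} * ((2 * R n + 1) * Real.log (1 + R (n + 1)))
    ≤ (1 / 2) ^ n

/-- Every ergodic transformation has a sequence of orbit changes which at stage `n + 1` are nearly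
mixing, on the first `n` sets of a given sequence, at a time `l n` that is insignificant for the
later changes. -/
theorem exists_isOrbitChangeSeq [StandardBorelSpace X] {μ : Measure X} [IsProbabilityMeasure μ]
    [NullSingletonClass μ] {S : X ≃ᵐ X} (hS : Ergodic S μ) {A : ℕ → Set X}
    (hA : ∀ i, MeasurableSet (A i)) :
    ∃ (T : ℕ → X ≃ᵐ X) (R l : ℕ → ℕ), IsOrbitChangeSeq μ S T R ∧ (∀ n, l n ≤ R (n + 1)) ∧
      ∀ n, ∀ i < n, ∀ j < n,
        |μ.real (A i ∩ iter (T (n + 1)) (l n) ⁻¹' A j) - μ.real (A i) * μ.real (A j)|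
          ≤ (1 / 2) ^ n := by
  let State := {p : (X ≃ᵐ X) × ℕ // Ergodic p.1 μ}
  have step : ∀ (n : ℕ) (p : State), ∃ (q : State) (D l : ℕ),
      q.1.2 = p.1.2 * D ∧ l ≤ D ∧ 2 ≤ D ∧
      (∀ x, ∃ k : ℤ, |k| ≤ D ∧ q.1.1 x = iter p.1.1 k x) ∧
      (∀ x, ∃ k : ℤ, |k| ≤ D ∧ p.1.1 x = iter q.1.1 k x) ∧
      μ.real {x | q.1.1 x ≠ p.1.1 x} * ((2 * p.1.2 + 1) * Real.log (1 + p.1.2 * D))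
        ≤ (1 / 2) ^ n ∧
      ∀ i < n, ∀ j < n, |μ.real (A i ∩ iter q.1.1 l ⁻¹' A j) - μ.real (A i) * μ.real (A j)|
          ≤ (1 / 2) ^ n := by
    rintro n ⟨⟨T, R⟩, hT⟩
    obtain ⟨U, D, l, hU, h1, h2, h3, h4, h5, h6⟩ := exists_orbit_change hT
      (A := fun i : Fin n => A i) (fun i => hA i) R (δ := (1 / 2) ^ n) (by positivity)
    exact ⟨⟨⟨U, R * D⟩, hU⟩, D, l, rfl, h1, h2, h3, h4, h5,
      fun i hi j hj => h6 ⟨i, hi⟩ ⟨j, hj⟩⟩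
  choose next D l hR hl hD h1 h2 h3 h4 using step
  let seq : ℕ → State := fun n => Nat.rec ⟨⟨S, 1⟩, hS⟩ (fun n p => next n p) n
  have hseq : ∀ n, seq (n + 1) = next n (seq n) := fun n => rfl
  have hRs : ∀ n, (seq (n + 1)).1.2 = (seq n).1.2 * D n (seq n) := fun n => hR n (seq n)
  have hpos : ∀ n, 1 ≤ (seq n).1.2 := by
    intro n
    induction n with
    | zero => exact le_rfl
    | succ n ih =>
      rw [hRs]
      exact Nat.mul_pos ih (by have := hD n (seq n); omega)
  have hDle : ∀ n, D n (seq n) ≤ (seq (n + 1)).1.2 := fun n => by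
    rw [hRs]; exact Nat.le_mul_of_pos_left _ (hpos n)
  refine ⟨fun n => (seq n).1.1, fun n => (seq n).1.2, fun n => l n (seq n), ?_,
    fun n => (hl n (seq n)).trans (hDle n), fun n => h4 n (seq n)⟩
  refine ⟨fun n => (seq n).2.toMeasurePreserving, monotone_nat_of_le_succ fun n => ?_, le_rfl,
    fun n => (hD n (seq n)).trans (hDle n), fun n => ?_, fun n => ?_, fun n => ?_⟩
  · rw [hRs]
    exact Nat.le_mul_of_pos_right _ (by have := hD n (seq n); omega)
  · induction n with
    | zero => exact fun x => ⟨1, by simp [seq], by simp [seq]⟩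
    | succ n ih =>
      intro x
      obtain ⟨k, hk, hkx⟩ := h1 n (seq n) x
      obtain ⟨j, hj, hjx⟩ := exists_iter_iter ih k x
      refine ⟨j, hj.trans ?_, ?_⟩
      · rw [hRs]
        push_cast
        rw [mul_comm]
        exact mul_le_mul_of_nonneg_left hk (by positivity)
      · rw [hseq, hkx, hjx]
  · induction n with
    | zero => exact fun x => ⟨1, by simp [seq], by simp [seq]⟩
    | succ n ih =>
      intro x
      obtain ⟨k, hk, hkx⟩ := ih x
      obtain ⟨j, hj, hjx⟩ := exists_iter_iter (h2 n (seq n)) k x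
      refine ⟨j, hj.trans ?_, ?_⟩
      · rw [hRs]
        push_cast
        exact mul_le_mul_of_nonneg_right hk (by positivity)
      · rw [hseq, hkx, hjx]
  · have := h3 n (seq n)
    rw [hseq, hR]
    push_cast
    exact this

/-- The limit of a sequence of measurable maps that are eventually constant at the points of `G`,
extended by the identity. -/
theorem exists_measurable_eventual {f : ℕ → X → X} (hf : ∀ n, Measurable (f n)) {E : ℕ → Set X}
    {G : Set X} (hE : ∀ n, MeasurableSet (E n)) (hG : MeasurableSet G)
    (hGE : ∀ x ∈ G, ∃ n, x ∈ E n) (h : ∀ m, ∀ x ∈ E m, ∀ n, m ≤ n → f n x = f m x) :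
    ∃ F : X → X, Measurable F ∧ (∀ x ∈ G, ∀ n, x ∈ E n → F x = f n x) ∧ ∀ x ∉ G, F x = x := by
  classical
  choose! m hm using hGE
  set F : X → X := fun x => if x ∈ G then f (m x) x else x with hF
  have h1 : ∀ x ∈ G, ∀ n, x ∈ E n → F x = f n x := by
    intro x hx n hn
    have e : F x = f (m x) x := if_pos hx
    rw [e, ← h _ x (hm x hx) _ (le_max_left (m x) n), ← h _ x hn _ (le_max_right (m x) n)]
  have h2 : ∀ x ∉ G, F x = x := fun x hx => if_neg hx
  refine ⟨F, ?_, h1, h2⟩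
  refine measurable_of_iUnion_eq (fun o : Option ℕ => o.elim Gᶜ fun n => G ∩ E n) ?_ ?_
    (fun o => o.elim id f) ?_ ?_
  · rintro (_ | n)
    · exact hG.compl
    · exact hG.inter (hE n)
  · intro x
    by_cases hx : x ∈ G
    · exact ⟨some (m x), hx, hm x hx⟩
    · exact ⟨none, hx⟩
  · rintro (_ | n)
    · exact measurable_id
    · exact hf n
  · rintro (_ | n) x hx
    · exact h2 x hx
    · exact h1 x hx.1 n hx.2

namespace IsOrbitChangeSeq

variable {μ : Measure X} {S : X ≃ᵐ X} {T : ℕ → X ≃ᵐ X} {R : ℕ → ℕ}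

/-- The points near which, along the orbits of `T n`, the transformations `T n` and `T (n + 1)`
differ. -/
def changeSet (T : ℕ → X ≃ᵐ X) (R : ℕ → ℕ) (n : ℕ) : Set X :=
  ⋃ j ∈ Finset.Icc (-R n : ℤ) (R n), iter (T n) j ⁻¹' {x | T (n + 1) x ≠ T n x}

/-- The points unaffected by the changes from stage `m` on. -/
def stableSet (T : ℕ → X ≃ᵐ X) (R : ℕ → ℕ) (m : ℕ) : Set X :=
  {x | ∀ n, m ≤ n → x ∉ changeSet T R n}

/-- The points whose `S`-orbit consists of points that are affected by finitely many changes. -/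
def goodSet (S : X ≃ᵐ X) (T : ℕ → X ≃ᵐ X) (R : ℕ → ℕ) : Set X :=
  {x | ∀ g : ℤ, ∃ m, iter S g x ∈ stableSet T R m}

theorem measurableSet_changeSet [MeasurableEq X] (n : ℕ) : MeasurableSet (changeSet T R n) := by
  refine Finset.measurableSet_biUnion _ fun j _ => measurable_iter _ _ ?_
  exact (measurableSet_eq_fun (T (n + 1)).measurable (T n).measurable).compl

theorem measurableSet_stableSet [MeasurableEq X] (m : ℕ) : MeasurableSet (stableSet T R m) := by
  have : stableSet T R m = ⋂ n, ⋂ _ : m ≤ n, (changeSet T R n)ᶜ := by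
    ext x; simp [stableSet]
  rw [this]
  exact .iInter fun n => .iInter fun _ => (measurableSet_changeSet n).compl

theorem measurableSet_goodSet [MeasurableEq X] : MeasurableSet (goodSet S T R) := by
  have : goodSet S T R = ⋂ g : ℤ, ⋃ m, iter S g ⁻¹' stableSet T R m := by
    ext x; simp [goodSet]
  rw [this]
  exact .iInter fun g => .iUnion fun m => measurable_iter S g (measurableSet_stableSet m)

theorem iter_mem_goodSet {x : X} (hx : x ∈ goodSet S T R) (g : ℤ) :
    iter S g x ∈ goodSet S T R := by
  intro j
  rw [← iter_add]
  exact hx _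

theorem exists_mem_stableSet {x : X} (hx : x ∈ goodSet S T R) : ∃ m, x ∈ stableSet T R m := by
  simpa using hx 0

theorem stableSet_mono {m n : ℕ} (h : m ≤ n) : stableSet T R m ⊆ stableSet T R n :=
  fun _ hx k hk => hx k (h.trans hk)

theorem iter_eq_of_notMem_changeSet {n : ℕ} {x : X} (hx : x ∉ changeSet T R n) {j : ℤ}
    (hj : |j| ≤ R n) : iter (T (n + 1)) j x = iter (T n) j x := by
  have hx' : ∀ j : ℤ, |j| ≤ R n → T (n + 1) (iter (T n) j x) = T n (iter (T n) j x) := by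
    intro j hj
    by_contra hne
    refine hx (Set.mem_biUnion (x := j) ?_ hne)
    rw [Finset.mem_coe, Finset.mem_Icc]
    exact abs_le.1 hj
  obtain ⟨k, rfl | rfl⟩ := j.eq_nat_or_neg
  · rw [Nat.abs_cast] at hj
    induction k with
    | zero => rfl
    | succ k ih =>
      have hk : (k : ℤ) ≤ R n := by push_cast at hj; omega
      rw [Nat.cast_succ, iter_add_one, iter_add_one, ih hk, hx' k (by simpa using hk)]
  · rw [abs_neg, Nat.abs_cast] at hj
    induction k with
    | zero => rfl
    | succ k ih =>
      have hk : (k : ℤ) ≤ R n := by push_cast at hj; omega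
      apply (T (n + 1)).injective
      rw [hx' _ (by rw [abs_neg, Nat.abs_cast]; exact hj), ← iter_add_one, ← iter_add_one]
      have e : (-((k + 1 : ℕ) : ℤ) + 1) = -(k : ℤ) := by push_cast; ring
      rw [e, ih hk]

theorem iter_eq_of_mem_stableSet (hs : IsOrbitChangeSeq μ S T R) {m n : ℕ} (hmn : m ≤ n) {x : X}
    (hx : x ∈ stableSet T R m) {j : ℤ} (hj : |j| ≤ R m) : iter (T n) j x = iter (T m) j x := by
  induction n, hmn using Nat.le_induction with
  | base => rfl
  | succ n hn ih =>
    rw [iter_eq_of_notMem_changeSet (hx n hn)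
      (hj.trans (by exact_mod_cast hs.monotone hn)), ih]

theorem one_le_all (hs : IsOrbitChangeSeq μ S T R) (n : ℕ) : 1 ≤ R n :=
  hs.one_le.trans (hs.monotone n.zero_le)

/-- The change set is covered by `2 R n + 1` translates of the set where `T (n + 1)` and `T n`
differ. -/
theorem measureReal_changeSet_mul_le (hs : IsOrbitChangeSeq μ S T R) (n : ℕ) :
    μ.real (changeSet T R n) * Real.log (1 + R (n + 1)) ≤ (1 / 2) ^ n := by
  have hlog : 0 ≤ Real.log (1 + R (n + 1)) := Real.log_nonneg (by
    have : (0 : ℝ) ≤ R (n + 1) := Nat.cast_nonneg _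
    linarith)
  have h1 : μ.real (changeSet T R n) ≤ (2 * R n + 1) * μ.real {x | T (n + 1) x ≠ T n x} := by
    refine (measureReal_biUnion_finset_le _ _).trans_eq ?_
    simp only [measureReal_preimage_iter (hs.measurePreserving n), Finset.sum_const,
      nsmul_eq_mul, Int.card_Icc]
    congr 1
    have : (((R n : ℤ) + 1 - -(R n : ℤ)).toNat : ℤ) = 2 * R n + 1 := by omega
    exact_mod_cast this
  calc μ.real (changeSet T R n) * Real.log (1 + R (n + 1))
      ≤ (2 * R n + 1) * μ.real {x | T (n + 1) x ≠ T n x} * Real.log (1 + R (n + 1)) := by gcongr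
    _ = μ.real {x | T (n + 1) x ≠ T n x} * ((2 * R n + 1) * Real.log (1 + R (n + 1))) := by ring
    _ ≤ (1 / 2) ^ n := hs.cost n

theorem tsum_changeSet_ne_top [IsFiniteMeasure μ] (hs : IsOrbitChangeSeq μ S T R) :
    ∑' n, μ (changeSet T R n) * ENNReal.ofReal (Real.log (1 + R (n + 1))) ≠ ⊤ := by
  have h : ∀ n, μ (changeSet T R n) * ENNReal.ofReal (Real.log (1 + R (n + 1)))
      ≤ ENNReal.ofReal ((1 / 2) ^ n) := by
    intro n
    rw [← ofReal_measureReal, ← ENNReal.ofReal_mul measureReal_nonneg]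
    exact ENNReal.ofReal_le_ofReal (hs.measureReal_changeSet_mul_le n)
  refine ne_top_of_le_ne_top ?_ (ENNReal.tsum_le_tsum h)
  exact summable_geometric_two.tsum_ofReal_ne_top

/-- The Borel–Cantelli lemma. -/
theorem ae_mem_goodSet [IsFiniteMeasure μ] (hs : IsOrbitChangeSeq μ S T R)
    (hS : MeasurePreserving S μ μ) : ∀ᵐ x ∂μ, x ∈ goodSet S T R := by
  have hsum : ∑' n, μ (changeSet T R n) ≠ ⊤ := by
    refine ne_top_of_le_ne_top hs.tsum_changeSet_ne_top (ENNReal.tsum_le_tsum fun n => ?_)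
    -- The logarithm is at least `1`, as `R (n + 1) ≥ 2` and `e < 3`.
    refine le_mul_of_one_le_right zero_le ?_
    rw [ENNReal.one_le_ofReal, Real.le_log_iff_exp_le (by positivity)]
    have h2 : (2 : ℝ) ≤ R (n + 1) := by exact_mod_cast hs.two_le n
    linarith [Real.exp_one_lt_d9]
  have hae : ∀ᵐ x ∂μ, ∃ m, x ∈ stableSet T R m := by
    filter_upwards [ae_eventually_notMem hsum] with x hx
    exact eventually_atTop.1 hx
  refine ae_all_iff.2 fun g => ?_
  exact (measurePreserving_iter hS g).quasiMeasurePreserving.ae hae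

/-- The limit of a sequence of orbit changes. -/
theorem exists_limit [MeasurableEq X] (hs : IsOrbitChangeSeq μ S T R) : ∃ U : X ≃ᵐ X,
    (∀ x ∈ goodSet S T R, ∀ m, x ∈ stableSet T R m → U x = T m x) ∧
    ∀ x ∉ goodSet S T R, U x = x := by
  have hT : ∀ n, ∀ x ∈ goodSet S T R, T n x ∈ goodSet S T R := by
    intro n x hx
    obtain ⟨k, -, hk⟩ := hs.exists_iter n x
    rw [hk]; exact iter_mem_goodSet hx k
  have hT' : ∀ n, ∀ x ∈ goodSet S T R, (T n).symm x ∈ goodSet S T R := by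
    intro n x hx
    obtain ⟨k, -, hk⟩ := hs.exists_iter n ((T n).symm x)
    rw [(T n).apply_symm_apply] at hk
    have : (T n).symm x = iter S (-k) x := by
      conv_rhs => rw [hk]
      simp
    rw [this]; exact iter_mem_goodSet hx _
  have hone : ∀ m, |(1 : ℤ)| ≤ R m := fun m => by
    have := hs.one_le_all m
    rw [abs_one]; exact_mod_cast this
  obtain ⟨f, hf, hf1, hf2⟩ := exists_measurable_eventual (f := fun n => T n)
    (E := stableSet T R) (G := goodSet S T R) (fun n => (T n).measurable) measurableSet_stableSet
    measurableSet_goodSet (fun x hx => exists_mem_stableSet hx) fun m x hx n hmn => by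
      simpa using hs.iter_eq_of_mem_stableSet hmn hx (hone m)
  obtain ⟨f', hf', hf1', hf2'⟩ := exists_measurable_eventual (f := fun n => (T n).symm)
    (E := stableSet T R) (G := goodSet S T R) (fun n => (T n).symm.measurable)
    measurableSet_stableSet
    measurableSet_goodSet (fun x hx => exists_mem_stableSet hx) fun m x hx n hmn => by
      have := hs.iter_eq_of_mem_stableSet hmn hx (j := -1) (by rw [abs_neg]; exact hone m)
      rwa [iter_neg_one, iter_neg_one] at this
  refine ⟨⟨⟨f, f', fun x => ?_, fun x => ?_⟩, hf, hf'⟩, hf1, hf2⟩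
  · by_cases hx : x ∈ goodSet S T R
    · obtain ⟨m, hm⟩ := exists_mem_stableSet hx
      have hy : f x ∈ goodSet S T R := by rw [hf1 x hx m hm]; exact hT m x hx
      obtain ⟨m', hm'⟩ := exists_mem_stableSet hy
      rw [hf1' _ hy _ (stableSet_mono (le_max_right m m') hm'),
        hf1 _ hx _ (stableSet_mono (le_max_left m m') hm), MeasurableEquiv.symm_apply_apply]
    · rw [hf2 x hx, hf2' x hx]
  · by_cases hx : x ∈ goodSet S T R
    · obtain ⟨m, hm⟩ := exists_mem_stableSet hx
      have hy : f' x ∈ goodSet S T R := by rw [hf1' x hx m hm]; exact hT' m x hx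
      obtain ⟨m', hm'⟩ := exists_mem_stableSet hy
      rw [hf1 _ hy _ (stableSet_mono (le_max_right m m') hm'),
        hf1' _ hx _ (stableSet_mono (le_max_left m m') hm), MeasurableEquiv.apply_symm_apply]
    · rw [hf2' x hx, hf2 x hx]

section Limit

variable {U : X ≃ᵐ X}

theorem limit_mem_orbit (hs : IsOrbitChangeSeq μ S T R)
    (hU : ∀ x ∈ goodSet S T R, ∀ m, x ∈ stableSet T R m → U x = T m x)
    {x : X} {m : ℕ} (hx : x ∈ goodSet S T R) (hm : x ∈ stableSet T R m) :
    ∃ k : ℤ, |k| ≤ R m ∧ U x = iter S k x := by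
  rw [hU x hx m hm]
  exact hs.exists_iter m x

theorem iter_limit_mem_goodSet (hs : IsOrbitChangeSeq μ S T R)
    (hU : ∀ x ∈ goodSet S T R, ∀ m, x ∈ stableSet T R m → U x = T m x)
    {x : X} (hx : x ∈ goodSet S T R) (k : ℕ) :
    iter U k x ∈ goodSet S T R := by
  induction k with
  | zero => exact hx
  | succ k ih =>
    obtain ⟨m, hm⟩ := exists_mem_stableSet ih
    obtain ⟨j, -, hj⟩ := hs.limit_mem_orbit hU ih hm
    rw [Nat.cast_succ, iter_add_one, hj]
    exact iter_mem_goodSet ih j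

theorem eventually_iter_eq_limit (hs : IsOrbitChangeSeq μ S T R)
    (hU : ∀ x ∈ goodSet S T R, ∀ m, x ∈ stableSet T R m → U x = T m x)
    {x : X} (hx : x ∈ goodSet S T R) (k : ℕ) :
    ∀ᶠ n in atTop, iter (T n) k x = iter U k x := by
  induction k with
  | zero => exact .of_forall fun _ => rfl
  | succ k ih =>
    have hy := hs.iter_limit_mem_goodSet hU hx k
    obtain ⟨m, hm⟩ := exists_mem_stableSet hy
    filter_upwards [ih, eventually_ge_atTop m] with n hn hmn
    rw [Nat.cast_succ, iter_add_one, iter_add_one, hn, hU _ hy n (stableSet_mono hmn hm)]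

/-- At stable points the powers of bounded exponent have reached their limits. -/
theorem iter_limit_eq (hs : IsOrbitChangeSeq μ S T R)
    (hU : ∀ x ∈ goodSet S T R, ∀ m, x ∈ stableSet T R m → U x = T m x)
    {x : X} {m : ℕ} (hx : x ∈ goodSet S T R) (hm : x ∈ stableSet T R m) {k : ℕ}
    (hk : k ≤ R m) : iter U k x = iter (T m) k x := by
  obtain ⟨n, hn, hmn⟩ := ((hs.eventually_iter_eq_limit hU hx k).and (eventually_ge_atTop m)).exists
  rw [← hn]
  exact hs.iter_eq_of_mem_stableSet hmn hm (by rw [Nat.abs_cast]; exact_mod_cast hk)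

/-- Backward iterates of good points are good, as the limit fixes all other points. -/
theorem iter_limit_mem_goodSet_int (hs : IsOrbitChangeSeq μ S T R)
    (hU : ∀ x ∈ goodSet S T R, ∀ m, x ∈ stableSet T R m → U x = T m x)
    (hU' : ∀ x ∉ goodSet S T R, U x = x) {x : X} (hx : x ∈ goodSet S T R) (g : ℤ) :
    iter U g x ∈ goodSet S T R := by
  obtain ⟨n, rfl | rfl⟩ := g.eq_nat_or_neg
  · exact hs.iter_limit_mem_goodSet hU hx n
  · by_contra hz
    have hfix : ∀ i : ℕ, iter U i (iter U (-n : ℤ) x) = iter U (-n : ℤ) x := by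
      intro i
      induction i with
      | zero => rfl
      | succ i ih => rw [Nat.cast_succ, iter_add_one, ih, hU' _ hz]
    have h2 := hfix n
    rw [iter_apply_iter_neg] at h2
    exact hz (h2 ▸ hx)

theorem mem_limit_orbit (hs : IsOrbitChangeSeq μ S T R)
    (hU : ∀ x ∈ goodSet S T R, ∀ m, x ∈ stableSet T R m → U x = T m x)
    (hU' : ∀ x ∉ goodSet S T R, U x = x) {x : X} {m : ℕ} (hx : x ∈ goodSet S T R)
    (hm : x ∈ stableSet T R m) :
    ∃ k : ℤ, |k| ≤ R m ∧ S x = iter U k x := by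
  obtain ⟨k, hk, hkx⟩ := hs.exists_iter' m x
  refine ⟨k, hk, ?_⟩
  obtain ⟨n, rfl | rfl⟩ := k.eq_nat_or_neg
  · rw [hkx, hs.iter_limit_eq hU hx hm (by simpa using hk)]
  · have hz := hs.iter_limit_mem_goodSet_int hU hU' hx (-n)
    obtain ⟨N, hN, hmN⟩ := ((hs.eventually_iter_eq_limit hU hz n).and
      (eventually_ge_atTop m)).exists
    rw [iter_apply_iter_neg] at hN
    rw [hkx, ← hs.iter_eq_of_mem_stableSet hmN hm hk]
    conv_lhs => rw [← hN]
    exact iter_neg_apply_iter _ _ _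

end Limit

end IsOrbitChangeSeq

end LimitTransformation

/-! ### The limit of a sequence of orbit changes is Shannon orbit equivalent -/

namespace IsOrbitChangeSeq

variable {X : Type*} [MeasurableSpace X] {μ : Measure X} [IsProbabilityMeasure μ]
  {S U : X ≃ᵐ X} {T : ℕ → X ≃ᵐ X} {R : ℕ → ℕ}

/-- A common bound, with finite integral, for the logarithms of the distances between `U x` and `x`
along the `S`-orbit and between `S x` and `x` along the `U`-orbit. -/
theorem exists_log_bound [MeasurableEq X] (hs : IsOrbitChangeSeq μ S T R) :
    ∃ L : X → ENNReal, Measurable L ∧ ∫⁻ x, L x ∂μ ≠ ⊤ ∧ ∀ x ∈ goodSet S T R,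
      ∃ m, x ∈ stableSet T R m ∧
        ∀ k : ℤ, |k| ≤ R m → ENNReal.ofReal (Real.log (1 + |(k : ℝ)|)) ≤ L x := by
  set c : ℕ → ENNReal := fun n => ENNReal.ofReal (Real.log (1 + R n)) with hc
  have hterm : ∀ n, Measurable fun x => (changeSet T R n).indicator (fun _ => c (n + 1)) x :=
    fun n => measurable_const.indicator (measurableSet_changeSet n)
  refine ⟨fun x => c 0 + ∑' n, (changeSet T R n).indicator (fun _ => c (n + 1)) x,
    measurable_const.add (Measurable.tsum hterm), ?_, fun x hx => ?_⟩
  · rw [lintegral_add_left measurable_const, lintegral_tsum fun n => (hterm n).aemeasurable]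
    refine ENNReal.add_ne_top.2 ⟨by simp [hc], ?_⟩
    have : ∀ n, ∫⁻ x, (changeSet T R n).indicator (fun _ => c (n + 1)) x ∂μ
        = μ (changeSet T R n) * ENNReal.ofReal (Real.log (1 + R (n + 1))) := fun n => by
      rw [lintegral_indicator_const (measurableSet_changeSet n), mul_comm]
    simp only [this]
    exact hs.tsum_changeSet_ne_top
  · classical
    have hex := exists_mem_stableSet hx
    refine ⟨Nat.find hex, Nat.find_spec hex, fun k hk => ?_⟩
    have h1 : ENNReal.ofReal (Real.log (1 + |(k : ℝ)|)) ≤ c (Nat.find hex) := by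
      refine ENNReal.ofReal_le_ofReal (Real.log_le_log (by positivity) ?_)
      have : |(k : ℝ)| ≤ R (Nat.find hex) := by exact_mod_cast hk
      linarith
    refine h1.trans ?_
    rcases hm : Nat.find hex with _ | n
    · exact le_self_add
    · -- The stage before the first stable one makes a change near `x`.
      have hmem : x ∈ changeSet T R n := by
        by_contra hnot
        refine Nat.find_min hex (m := n) (by omega) fun i hi => ?_
        rcases hi.eq_or_lt with rfl | hi
        · exact hnot
        · exact (hm ▸ Nat.find_spec hex) i hi
      refine le_trans ?_ le_add_self
      refine le_trans ?_ (ENNReal.le_tsum n)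
      rw [Set.indicator_of_mem hmem]

theorem tendsto_measureReal_compl_stable [MeasurableEq X] (hs : IsOrbitChangeSeq μ S T R)
    (hS : MeasurePreserving S μ μ) :
    Tendsto (fun m => μ.real (stableSet T R m ∩ goodSet S T R)ᶜ) atTop (𝓝 0) := by
  have hanti : Antitone fun m => (stableSet T R m ∩ goodSet S T R)ᶜ := fun m n hmn =>
    Set.compl_subset_compl.2 (Set.inter_subset_inter_left _ (stableSet_mono hmn))
  have h := tendsto_measure_iInter_atTop (μ := μ)
    (fun m => ((measurableSet_stableSet m).inter
      (measurableSet_goodSet (S := S))).compl.nullMeasurableSet) hanti ⟨0, measure_ne_top _ _⟩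
  have h0 : μ (⋂ m, (stableSet T R m ∩ goodSet S T R)ᶜ) = 0 := by
    refine measure_mono_null ?_ (ae_iff.1 (hs.ae_mem_goodSet hS))
    intro x hx hgood
    obtain ⟨m, hm⟩ := exists_mem_stableSet hgood
    exact Set.mem_iInter.1 hx m ⟨hm, hgood⟩
  rw [h0] at h
  exact (ENNReal.tendsto_toReal ENNReal.zero_ne_top).comp h

/-- The minimal exponents expressing `S` and the limit `U` through each other are bounded in terms
of the first stable stage, whose logarithm is integrable. -/
theorem isShannonOrbitEquivalent_limit [MeasurableEq X] (hs : IsOrbitChangeSeq μ S T R)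
    (hS : MeasurePreserving S μ μ) (hfree : IsFree μ S) (hUmp : MeasurePreserving U μ μ)
    (hU : ∀ x ∈ goodSet S T R, ∀ m, x ∈ stableSet T R m → U x = T m x)
    (hU' : ∀ x ∉ goodSet S T R, U x = x) : IsShannonOrbitEquivalent μ S U := by
  obtain ⟨L, hL, hLfin, hLx⟩ := hs.exists_log_bound
  have hGm : MeasurableSet (goodSet S T R) := measurableSet_goodSet
  have hGae := hs.ae_mem_goodSet hS
  have hUG : ∀ x ∈ goodSet S T R, ∀ g, iter U g x ∈ goodSet S T R :=
    fun x hx g => hs.iter_limit_mem_goodSet_int hU hU' hx g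
  choose κ hκm hκ hκH using exists_exponent_hasFiniteShannonEntropy (P := U) (Q := S) hS hGm hGae
    (fun x hx g => iter_mem_goodSet hx g) hL hLfin (fun x hx => by
      obtain ⟨m, hm, hmL⟩ := hLx x hx
      obtain ⟨k, hk, hkx⟩ := hs.mem_limit_orbit hU hU' hx hm
      exact ⟨k, hkx, hmL k hk⟩)
  choose lam hlm hl hlH using exists_exponent_hasFiniteShannonEntropy (P := S) (Q := U) hUmp hGm
    hGae hUG hL hLfin (fun x hx => by
      obtain ⟨m, hm, hmL⟩ := hLx x hx
      obtain ⟨k, hk, hkx⟩ := hs.limit_mem_orbit hU hx hm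
      exact ⟨k, hkx, hmL k hk⟩)
  have horb : ∀ᵐ x ∂μ, (Set.range fun g : ℤ => iter S g x) = Set.range fun g : ℤ => iter U g x := by
    filter_upwards [hGae] with x hx
    apply Set.Subset.antisymm
    · rintro _ ⟨g, rfl⟩
      exact ⟨_, hκ g x hx⟩
    · rintro _ ⟨g, rfl⟩
      exact ⟨_, hl g x hx⟩
  refine ⟨hfree, ?_, horb, fun x g => κ g x, fun x g => lam g x, hκm, hlm, ?_, ?_, hκH, hlH⟩
  · filter_upwards [hfree, horb] with x hx1 hx2 g hg
    exact iter_ne_self_of_range_eq hx1 hx2 hg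
  · filter_upwards [hGae] with x hx g using hκ g x hx
  · filter_upwards [hGae] with x hx g using hl g x hx

theorem abs_measureReal_limit_sub_le (hs : IsOrbitChangeSeq μ S T R)
    (hU : ∀ x ∈ goodSet S T R, ∀ m, x ∈ stableSet T R m → U x = T m x) {l m : ℕ} (hl : l ≤ R m)
    (A B : Set X) :
    |μ.real (A ∩ iter U l ⁻¹' B) - μ.real (A ∩ iter (T m) l ⁻¹' B)|
      ≤ μ.real (stableSet T R m ∩ goodSet S T R)ᶜ := by
  have key : ∀ x ∈ stableSet T R m ∩ goodSet S T R, iter U l x = iter (T m) l x := fun x hx =>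
    hs.iter_limit_eq hU hx.2 hx.1 hl
  refine abs_measureReal_sub_le _ _ _ (fun x hx => ?_) (fun x hx => ?_)
  · by_cases hxs : x ∈ stableSet T R m ∩ goodSet S T R
    · refine .inl ⟨hx.1, ?_⟩
      rw [Set.mem_preimage, ← key x hxs]; exact hx.2
    · exact .inr hxs
  · by_cases hxs : x ∈ stableSet T R m ∩ goodSet S T R
    · refine .inl ⟨hx.1, ?_⟩
      rw [Set.mem_preimage, key x hxs]; exact hx.2
    · exact .inr hxs

end IsOrbitChangeSeq

/-! ### Weak mixing up to Shannon orbit equivalence -/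

section Main

variable {X : Type*} [MeasurableSpace X] [StandardBorelSpace X] {μ : Measure X}
  [IsProbabilityMeasure μ] [NullSingletonClass μ]

open IsOrbitChangeSeq in
/-- The limit of a sequence of orbit changes that are chosen to mix more and more sets of a dense
sequence is weak mixing. -/
theorem exists_isWeakMixing_isShannonOrbitEquivalent {S : X ≃ᵐ X} (hS : Ergodic S μ) :
    ∃ T : X ≃ᵐ X, MeasurePreserving T μ μ ∧ IsWeakMixing μ T ∧
      IsShannonOrbitEquivalent μ S T := by
  have hSmp := hS.toMeasurePreserving
  obtain ⟨𝒜, h𝒜c, h𝒜⟩ := (inferInstance : MeasureTheory.IsSeparable μ).exists_countable_measureDense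
  obtain ⟨A, rfl⟩ := h𝒜c.exists_eq_range h𝒜.nonempty
  obtain ⟨T, R, l, hs, hl, hmix⟩ := exists_isOrbitChangeSeq hS
    fun i => h𝒜.measurable (A i) (Set.mem_range_self i)
  obtain ⟨U, hU, hU'⟩ := hs.exists_limit
  have hUmp : MeasurePreserving U μ μ := measurePreserving_of_mem_orbit hSmp fun x => by
    by_cases hx : x ∈ goodSet S T R
    · obtain ⟨m, hm⟩ := exists_mem_stableSet hx
      obtain ⟨k, -, hk⟩ := hs.limit_mem_orbit hU hx hm
      exact ⟨k, hk⟩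
    · exact ⟨0, hU' x hx⟩
  refine ⟨U, hUmp, ?_, hs.isShannonOrbitEquivalent_limit hSmp (isFree_of_ergodic hS) hUmp hU hU'⟩
  refine isWeakMixing_of_tendsto (fun n => (l n : ℤ)) (fun B C hB hC =>
    tendsto_measureReal_inter_of_dense hUmp _ (Set.range A) (fun B hB ε hε => ?_) ?_ hB hC) hUmp
  · obtain ⟨B', hB', hlt⟩ := h𝒜.approx B hB (measure_ne_top _ _) ε hε
    exact ⟨B', hB', ENNReal.toReal_le_of_le_ofReal hε.le hlt.le⟩
  · rintro _ ⟨i, rfl⟩ _ ⟨j, rfl⟩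
    rw [tendsto_iff_dist_tendsto_zero]
    have hlim : Tendsto (fun n => μ.real (stableSet T R (n + 1) ∩ goodSet S T R)ᶜ + (1 / 2) ^ n)
        atTop (𝓝 0) := by
      have h1 := (tendsto_add_atTop_iff_nat 1).2 (hs.tendsto_measureReal_compl_stable hSmp)
      have h2 := tendsto_pow_atTop_nhds_zero_of_lt_one (r := (1 / 2 : ℝ)) (by norm_num)
        (by norm_num)
      simpa using h1.add h2
    refine squeeze_zero' (.of_forall fun _ => dist_nonneg) ?_ hlim
    filter_upwards [eventually_gt_atTop (max i j)] with n hn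
    rw [Real.dist_eq]
    refine (abs_sub_le _ (μ.real (A i ∩ iter (T (n + 1)) (l n) ⁻¹' A j)) _).trans ?_
    exact add_le_add (hs.abs_measureReal_limit_sub_le hU (hl n) _ _)
      (hmix n i ((le_max_left i j).trans_lt hn) j ((le_max_right i j).trans_lt hn))

end Main

end ShannonOE
end

theorem theorem7p18 {X : Type*} [MeasurableSpace X] [StandardBorelSpace X]
    (μ : Measure X) [IsProbabilityMeasure μ] [NullSingletonClass μ] :
    -- every ergodic transformation is Shannon orbit equivalent to a weak mixing one
    (∀ S : X ≃ᵐ X, Ergodic S μ →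
      ∃ T : X ≃ᵐ X, MeasurePreserving T μ μ ∧ ShannonOE.IsWeakMixing μ T ∧
        ShannonOE.IsShannonOrbitEquivalent μ S T) ∧
    -- the criterion for weak mixing of a limit of actions
    (∀ (S T : X ≃ᵐ X), MeasurePreserving S μ μ → MeasurePreserving T μ μ →
      ∀ α : ℕ → X → ℤ → ℤ, (∀ n, ShannonOE.IsCocycle μ S (α n)) →
      ShannonOE.ConvergesTo μ (fun n => ShannonOE.twist S (α n)) T →
      ∀ (l : ℕ → ℤ) (δ : ℕ → ℝ) (P : ℕ → ℕ → Set X) (k : ℕ → ℕ),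
        Tendsto δ atTop (𝓝 0) →
        (∀ n, ShannonOE.IsMeasurablePartition (P n)) →
        (∀ n, ShannonOE.Refines (P (n + 1)) (P n)) →
        ShannonOE.GeneratesModNull μ P →
        StrictMono k →
        (∀ i j : ℕ, i ≤ j →
          ShannonOE.IsMixingRel μ (ShannonOE.twist S (α (k j))) (δ i) (l i) (P i)) →
        ShannonOE.IsWeakMixing μ T) :=
  ⟨fun _ hS => ShannonOE.exists_isWeakMixing_isShannonOrbitEquivalent hS,
    fun _ _ _ hT _ _ hconv _ _ _ _ hδ hP hr hg hk h =>
      ShannonOE.isWeakMixing_of_convergesTo hT hconv hδ hP hr hg hk h⟩
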